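/- Let $K = T\times K_1\times\cdots\times K_m$, where $T$ is a torus (possibly trivial) and $K_1,\dots,K_m$ are compact connected Lie groups with simple Lie algebras. For each $i$ let $V_i$ be a finite-dimensional Hermitian space carrying a complex irreducible unitary representation of $K_i$. Let $V = V_1\otimes_{\mathbb C}\cdots\otimes_{\mathbb C}V_m$, with the Hermitian product determined by $$\langle u_1\otimes\cdots\otimes u_m,\ u_1'\otimes\cdots\otimes u_m'\rangle=\prod_{i=1}^m\langle u_i,u_i'\rangle ,$$ carry a complex irreducible unitary representation of $K$ for which $K_1\times\cdots\times K_m$ acts by the tensor product of the given representations. For each $i$ fix a maximal torus of $K_i$ and a system of positive roots, let $p_i\in V_i$ be a highest weight vector of unit length, and put $p=p_1\otimes\cdots\otimes p_m$. For a point $q$ of the unit sphere of one of these Hermitian spaces (regarded as a Euclidean space with inner product $\operatorname{Re}\langle\cdot,\cdot\rangle$), let $\mathrm{II}$ be the second fundamental form at $q$ of the orbit of $q$ as a submanifold of the unit sphere, and let $$\|\mathrm{II}\|_\infty=\sup\{\|\mathrm{II}(u,v)\| : u,v \text{ tangent to the orbit at } q,\ \|u\|=\|v\|=1\}$$ (equal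 to $0$ if the orbit is $0$-dimensional). Let $\mathrm{II}_i$ be the second fundamental form of $K_ip_i$ at $p_i$ in the unit sphere of $V_i$, and $\mathrm{II}$ that of $Kp$ at $p$ in the unit sphere of $V$. If $C$ is a real number with $C\ge\max\{\|\mathrm{II}_1\|_\infty,\dots,\|\mathrm{II}_m\|_\infty,\sqrt2\}$, then $C\ge\|\mathrm{II}\|_\infty$. -/

import Mathlib

open scoped Manifold ContDiff ENNReal TensorProduct

noncomputable section

namespace OrbitSFF

/-! ### Second fundamental forms in the unit sphere of a Euclidean space -/

section Geometry

variable {E : Type*} [NormedAddCommGroup E] [InnerProductSpace ℝ E] [FiniteDimensional ℝ E]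

/-- The normal space at `p` of a submanifold of the unit sphere of `E` with tangent space `S`
at `p`, the normal space being taken inside the tangent space `pᗮ` of the sphere. -/
def normalSpace (S : Submodule ℝ E) (p : E) : Submodule ℝ E :=
  (Submodule.span ℝ {p} ⊔ S)ᗮ

/-- `Y` is (a smooth extension to `E` of) a vector field tangent to the submanifold `M`,
whose tangent space at `q ∈ M` is `T q`. -/
structure IsTangentField (M : Set E) (T : E → Submodule ℝ E) (Y : E → E) : Prop where
  contDiff : ContDiff ℝ ∞ Y
  mem : ∀ q ∈ M, Y q ∈ T q

open Classical in
/-- The second fundamental form `II_p(u, v)` of a submanifold `M` of the unit sphere of `E`, with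
tangent spaces `T q`, `q ∈ M`: the normal component of the derivative at `p` in the direction `u`
of a tangent field `Y` of `M` with `Y p = v`.  (The normal component in the sphere of the
Levi-Civita derivative of the sphere is that of the flat derivative, since `normalSpace` is
orthogonal to `p`; it does not depend on the choice of `Y`.) -/
def secondFundForm (M : Set E) (T : E → Submodule ℝ E) (p u v : E) : E :=
  if h : ∃ Y : E → E, IsTangentField M T Y ∧ Y p = v then
    (normalSpace (T p) p).starProjection (fderiv ℝ h.choose p u)
  else 0

/-- The supremum norm `sup { ‖II_p(u, v)‖ : u, v ∈ T_p M, ‖u‖ = ‖v‖ = 1 }` (it is `0` if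
`T_p M = 0`). -/
def secondFundNorm (M : Set E) (T : E → Submodule ℝ E) (p : E) : ℝ≥0∞ :=
  ⨆ (u ∈ T p) (v ∈ T p) (_ : ‖u‖ = 1) (_ : ‖v‖ = 1), ‖secondFundForm M T p u v‖ₑ

end Geometry

/-! ### Unitary representations of Lie groups and their orbits -/

section Representation

variable {F : Type*} [NormedAddCommGroup F] [NormedSpace ℝ F] {H : Type*} [TopologicalSpace H]

/-- A (smooth) unitary representation of the Lie group `G` on the Hermitian space `V`. -/
structure UnitaryRep (I : ModelWithCorners ℝ F H) (G : Type*) [TopologicalSpace G]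
    [ChartedSpace H G] [Group G] (V : Type*) [NormedAddCommGroup V] [InnerProductSpace ℂ V] where
  toHom : G →* (V →L[ℂ] V)
  smooth : ContMDiff I 𝓘(ℝ, V →L[ℂ] V) ∞ (fun g => toHom g)
  inner_map : ∀ (g : G) (u v : V), inner ℂ (toHom g u) (toHom g v) = inner ℂ u v

namespace UnitaryRep

variable {I : ModelWithCorners ℝ F H} {G : Type*} [TopologicalSpace G] [ChartedSpace H G] [Group G]
  {V : Type*} [NormedAddCommGroup V] [InnerProductSpace ℂ V]

/-- Complex irreducibility. -/
def IsIrreducible (ρ : UnitaryRep I G V) : Prop :=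
  Nontrivial V ∧
    ∀ S : Submodule ℂ V, (∀ g : G, ∀ v ∈ S, ρ.toHom g v ∈ S) → S = ⊥ ∨ S = ⊤

/-- The orbit `G p`. -/
def orbit (ρ : UnitaryRep I G V) (p : V) : Set V :=
  Set.range fun g : G => ρ.toHom g p

/-- The derivative `T_1 G → V` at the identity of the orbit map `g ↦ g q`. -/
def orbitDeriv (ρ : UnitaryRep I G V) (q : V) : GroupLieAlgebra I G →L[ℝ] V :=
  mfderiv I 𝓘(ℝ, V) (fun g : G => ρ.toHom g q) 1

/-- The tangent space at `q` of the orbit `G q`: the image of the tangent space `T_1 G` under the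
derivative of the orbit map `g ↦ g q`. -/
def orbitTangent (ρ : UnitaryRep I G V) (q : V) : Submodule ℝ V :=
  LinearMap.range (ρ.orbitDeriv q).toLinearMap

/-- `‖II‖_∞` for the orbit `G p` at `p` in the unit sphere of `V`, where `V` carries the real
inner product `Re ⟨·,·⟩`. -/
def orbitSecondFundNorm [FiniteDimensional ℂ V] (ρ : UnitaryRep I G V) (p : V) : ℝ≥0∞ :=
  letI : InnerProductSpace ℝ V := InnerProductSpace.complexToReal
  haveI : FiniteDimensional ℝ V := FiniteDimensional.complexToReal V
  secondFundNorm (ρ.orbit p) ρ.orbitTangent p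

/-- The differential of the representation at the identity, a map from the Lie algebra. -/
def differential (ρ : UnitaryRep I G V) : GroupLieAlgebra I G →L[ℝ] (V →L[ℂ] V) :=
  mfderiv I 𝓘(ℝ, V →L[ℂ] V) (fun g : G => ρ.toHom g) 1

end UnitaryRep

/-- A smooth real Lie group is a Lie group in the sense needed for its Lie algebra. -/
instance lieGroup_minSmoothness {I : ModelWithCorners ℝ F H} {G : Type*} [TopologicalSpace G]
    [ChartedSpace H G] [Group G] [LieGroup I ∞ G] : LieGroup I (minSmoothness ℝ 3) G := by
  rw [minSmoothness_of_isRCLikeNormedField]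
  infer_instance

end Representation

/-! ### Roots and positive systems -/

section Roots

/-- The extension of scalars `A ⊗ L` of a Lie algebra `L` over `R`. -/
abbrev ExtendLie (R A L : Type*) [CommRing R] [CommRing A] [Algebra R A] [LieRing L]
    [LieAlgebra R L] : Type _ := A ⊗[R] L

/-- The complexification `L ⊗ ℂ` of a real Lie algebra `L`. -/
abbrev Complexification (L : Type*) [LieRing L] [LieAlgebra ℝ L] : Type _ := ExtendLie ℝ ℂ L

variable {L : Type*} [LieRing L] [LieAlgebra ℝ L]

/-- The element `c ⊗ x` of the complexification. -/
abbrev ctmul (c : ℂ) (x : L) : Complexification L := TensorProduct.tmul ℝ c x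

/-- `t` is a maximal abelian subalgebra; for the Lie algebra of a compact connected Lie group,
these are the Lie algebras of the maximal tori. -/
def IsMaximalAbelian (t : LieSubalgebra ℝ L) : Prop :=
  Maximal (fun s : LieSubalgebra ℝ L => IsLieAbelian s) t

/-- `{ z ∈ L ⊗ ℂ : [h, z] = α(h) z for all h ∈ t }`. -/
def rootSpace (t : LieSubalgebra ℝ L) (α : t → ℂ) : Submodule ℂ (Complexification L) where
  carrier := {z | ∀ h : t, ⁅ctmul 1 (h : L), z⁆ = α h • z}
  add_mem' := fun {x y} hx hy h => by
    rw [lie_add, hx h, hy h, smul_add]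
  zero_mem' := fun h => by rw [lie_zero, smul_zero]
  smul_mem' := fun c x hx h => by
    rw [lie_smul, hx h, smul_comm]

/-- The roots of `L ⊗ ℂ` with respect to `t` (such a function `α` is automatically linear). -/
def roots (t : LieSubalgebra ℝ L) : Set (t → ℂ) :=
  {α | α ≠ 0 ∧ rootSpace t α ≠ ⊥}

/-- `P` is a system of positive roots. -/
structure IsPositiveSystem (t : LieSubalgebra ℝ L) (P : Set (t → ℂ)) : Prop where
  subset : P ⊆ roots t
  mem_iff : ∀ α ∈ roots t, α ∈ P ↔ -α ∉ P
  add_mem : ∀ α ∈ P, ∀ β ∈ P, α + β ∈ roots t → α + β ∈ P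

end Roots

/-! ### Highest weight vectors -/

namespace UnitaryRep

variable {F : Type*} [NormedAddCommGroup F] [NormedSpace ℝ F] [CompleteSpace F]
  {H : Type*} [TopologicalSpace H] {I : ModelWithCorners ℝ F H} {G : Type*}
  [TopologicalSpace G] [ChartedSpace H G] [Group G] [LieGroup I ∞ G]
  {V : Type*} [NormedAddCommGroup V] [InnerProductSpace ℂ V]

/-- The complex linear extension `c ⊗ x ↦ c dρ(x)` of the differential to the complexified Lie
algebra. -/
def complexDifferential (ρ : UnitaryRep I G V) :
    Complexification (GroupLieAlgebra I G) →ₗ[ℂ] (V →L[ℂ] V) :=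
  LinearMap.liftBaseChange ℂ ρ.differential.toLinearMap

/-- `v` is a highest weight vector with respect to the maximal abelian subalgebra `t` and the
system `P` of positive roots: a weight vector annihilated by all positive root spaces. -/
def IsHighestWeightVector (ρ : UnitaryRep I G V)
    (t : LieSubalgebra ℝ (GroupLieAlgebra I G)) (P : Set (t → ℂ)) (v : V) : Prop :=
  v ≠ 0 ∧
    (∃ l : t → ℂ, ∀ h : t, ρ.differential (h : GroupLieAlgebra I G) v = l h • v) ∧
    ∀ α ∈ P, ∀ z ∈ rootSpace t α, ρ.complexDifferential z v = 0

end UnitaryRep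

/-! ### Tensor products of Hermitian spaces -/

/-- `τ : ∏ i, V i → W` exhibits the Hermitian space `W` as the tensor product of the Hermitian
spaces `V i` over `ℂ`, with the product Hermitian form
`⟨u₁ ⊗ ⋯ ⊗ uₘ, v₁ ⊗ ⋯ ⊗ vₘ⟩ = ⟨u₁, v₁⟩ ⋯ ⟨uₘ, vₘ⟩`. -/
structure IsHermitianTensorProduct {ι : Type*} [Fintype ι] {V : ι → Type*}
    [∀ i, NormedAddCommGroup (V i)] [∀ i, InnerProductSpace ℂ (V i)]
    {W : Type*} [NormedAddCommGroup W] [InnerProductSpace ℂ W]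
    (τ : MultilinearMap ℂ V W) : Prop where
  bijective_lift : Function.Bijective (PiTensorProduct.lift τ)
  inner_map : ∀ u v : ∀ i, V i, inner ℂ (τ u) (τ v) = ∏ i, inner ℂ (u i) (v i)

end OrbitSFF

end

noncomputable section

namespace OrbitSFF

namespace UnitaryRep

/-! ### Differentiating a unitary representation at the identity -/

section Basic

variable {F : Type*} [NormedAddCommGroup F] [NormedSpace ℝ F] {H : Type*} [TopologicalSpace H]
  {I : ModelWithCorners ℝ F H} {G : Type*} [TopologicalSpace G] [ChartedSpace H G] [Group G]
  {V : Type*} [NormedAddCommGroup V] [InnerProductSpace ℂ V]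

/-! The highest weight condition controls the tangent space `S` of each factor orbit at `p i`. By
simplicity the differential is zero or faithful; in the faithful case decompose the complexified Lie
algebra under `t`. Weight zero sends `p i` to multiples of itself, and positive root vectors kill
it. If A + iB is a negative root vector, then A - iB is a positive one and kills `p i`, so (A + iB)
p_i = 2 A p_i lies in `S`; the same applies to i(A + iB). Hence X p_i = i r p_i + n with r real and
n in the largest complex subspace N_i of `S`, which is Hermitian orthogonal to `p i`
(`exists_differential_apply_eq`). A commutator argument shows that either `S` is zero or it contains
i p_i (`orbitTangent_eq_bot_or_I_smul_mem`); in the second case normal vectors are Hermitian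
orthogonal to `p i`.

The torus acts by scalars, by Schur's lemma. So unit tangent vectors u, v of the product orbit are
imaginary multiples of p plus sums of tensors in which one p_i is replaced by m_i, respectively n_i,
in N_i. Choose X with X_i p_i = n_i and extend v to a linear tangent field X + ia. Modulo the span
of p and the tangent space, its derivative along u is the sum of the tensors with w_i = II_i(m_i,
n_i) in slot i and of those with m_i in slot i and n_j in slot j, for i ≠ j
(`norm_secondFundForm_tensor_le`).

Tensors altered in different sets of slots are orthogonal, so only the pairs (i, j) and (j, i)
interact. The squared norm is at most Σ ‖w_i‖² + 2 Σ_{i≠j} ‖m_i‖² ‖n_j‖², hence at most C² (Σ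
‖m_i‖²)(Σ ‖n_j‖²) ≤ C² (`norm_sum_le`). The bound C ≥ √2 pays for the mixed terms, and the bounds on
the factors for the w_i. -/

theorem mdifferentiableAt_toHom (ρ : UnitaryRep I G V) (g : G) :
    MDifferentiableAt I 𝓘(ℝ, V →L[ℂ] V) (fun g => ρ.toHom g) g :=
  (ρ.smooth g).mdifferentiableAt (by simp)

theorem hasMFDerivAt_toHom (ρ : UnitaryRep I G V) :
    HasMFDerivAt I 𝓘(ℝ, V →L[ℂ] V) (fun g => ρ.toHom g) 1 ρ.differential :=
  (ρ.mdifferentiableAt_toHom 1).hasMFDerivAt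

/-- The chain rule for a function of the operators `ρ g`. -/
theorem hasMFDerivAt_comp_toHom (ρ : UnitaryRep I G V) {E : Type*} [NormedAddCommGroup E]
    [NormedSpace ℝ E] {Ψ : (V →L[ℂ] V) → E} {Ψ' : (V →L[ℂ] V) →L[ℝ] E} (h : HasFDerivAt Ψ Ψ' 1) :
    HasMFDerivAt I 𝓘(ℝ, E) (fun g => Ψ (ρ.toHom g)) 1 (Ψ' ∘L ρ.differential) := by
  have h' : HasFDerivAt Ψ Ψ' (ρ.toHom 1) := by rwa [map_one]
  exact h'.hasMFDerivAt.comp (1 : G) ρ.hasMFDerivAt_toHom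

/-- The device for turning an identity valid on the whole group into an infinitesimal one: a
constant function has zero derivative. -/
theorem apply_differential_eq_zero (ρ : UnitaryRep I G V) {E : Type*} [NormedAddCommGroup E]
    [NormedSpace ℝ E] {Ψ : (V →L[ℂ] V) → E} {Ψ' : (V →L[ℂ] V) →L[ℝ] E} (h : HasFDerivAt Ψ Ψ' 1)
    {c : E} (hc : ∀ g, Ψ (ρ.toHom g) = c) (X : GroupLieAlgebra I G) :
    Ψ' (ρ.differential X) = 0 := by
  have h1 := ρ.hasMFDerivAt_comp_toHom h
  have h2 : (fun g => Ψ (ρ.toHom g)) = fun _ => c := funext hc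
  rw [h2] at h1
  exact DFunLike.congr_fun (hasMFDerivAt_unique h1 (hasMFDerivAt_const c (1 : G))) X

/-- Evaluation at a vector, as a real linear map. -/
def evalAt (q : V) : (V →L[ℂ] V) →L[ℝ] V :=
  (ContinuousLinearMap.apply ℂ V q).restrictScalars ℝ

@[simp]
theorem evalAt_apply (q : V) (A : V →L[ℂ] V) : evalAt q A = A q := rfl

theorem orbitDeriv_apply (ρ : UnitaryRep I G V) (q : V) (X : GroupLieAlgebra I G) :
    ρ.orbitDeriv q X = ρ.differential X q := by
  have h := (ρ.hasMFDerivAt_comp_toHom (evalAt q).hasFDerivAt).mfderiv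
  exact DFunLike.congr_fun h X

theorem mem_orbitTangent (ρ : UnitaryRep I G V) {q v : V} :
    v ∈ ρ.orbitTangent q ↔ ∃ X, ρ.differential X q = v := by
  simp only [orbitTangent, LinearMap.mem_range]
  exact exists_congr fun X => by rw [← orbitDeriv_apply]; rfl

theorem differential_mem_orbitTangent (ρ : UnitaryRep I G V) (X : GroupLieAlgebra I G) (q : V) :
    ρ.differential X q ∈ ρ.orbitTangent q :=
  ρ.mem_orbitTangent.2 ⟨X, rfl⟩

theorem inner_differential (ρ : UnitaryRep I G V) (X : GroupLieAlgebra I G) (u v : V) :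
    inner ℂ (ρ.differential X u) v = -inner ℂ u (ρ.differential X v) := by
  have h := ((evalAt u).hasFDerivAt (x := 1)).inner ℂ ((evalAt v).hasFDerivAt (x := 1))
  have := ρ.apply_differential_eq_zero h (c := inner ℂ u v) (fun g => ρ.inner_map g u v) X
  simp [fderivInnerCLM_apply] at this
  linear_combination this

theorem toHom_inv_apply (ρ : UnitaryRep I G V) (g : G) (v : V) :
    ρ.toHom g⁻¹ (ρ.toHom g v) = v := by
  rw [← mul_apply_eq_comp, ← map_mul]; simp

end Basic

/-! ### The adjoint action and the Lie bracket -/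

section LieGroup

variable {F : Type*} [NormedAddCommGroup F] [NormedSpace ℝ F] {H : Type*} [TopologicalSpace H]
  {I : ModelWithCorners ℝ F H} {G : Type*} [TopologicalSpace G] [ChartedSpace H G] [Group G]
  [LieGroup I ∞ G]
  {V : Type*} [NormedAddCommGroup V] [InnerProductSpace ℂ V]

/-- The adjoint action: conjugates of `dρ(X)` by `ρ g` are again in the image of `dρ`. -/
theorem exists_differential_conj (ρ : UnitaryRep I G V) (g : G) (X : GroupLieAlgebra I G) :
    ∃ X', ∀ v, ρ.differential X (ρ.toHom g v) = ρ.toHom g (ρ.differential X' v) := by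
  have hc : MDifferentiableAt I I (fun h : G => g⁻¹ * h * g) 1 :=
    ((contMDiff_mul_right (I := I) (n := ∞) (a := g)).comp
      (contMDiff_mul_left (I := I) (n := ∞) (a := g⁻¹)) 1).mdifferentiableAt (by simp)
  -- The witness is Ad(g⁻¹) X, the derivative at 1 of conjugation by g⁻¹.
  refine ⟨mfderiv I I (fun h : G => g⁻¹ * h * g) 1 X, fun v => ?_⟩
  have h1 : HasMFDerivAt I 𝓘(ℝ, V →L[ℂ] V) (fun h => ρ.toHom (g⁻¹ * h * g)) 1
      (mfderiv I 𝓘(ℝ, V →L[ℂ] V) (fun g => ρ.toHom g) (g⁻¹ * 1 * g) ∘L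
        mfderiv I I (fun h : G => g⁻¹ * h * g) 1) :=
    (ρ.mdifferentiableAt_toHom (g⁻¹ * 1 * g)).hasMFDerivAt.comp (1 : G) hc.hasMFDerivAt
  let Ψ : (V →L[ℂ] V) →L[ℝ] V :=
    ((ρ.toHom g⁻¹).restrictScalars ℝ) ∘L evalAt (ρ.toHom g v)
  have h3 := ρ.hasMFDerivAt_comp_toHom (Ψ.hasFDerivAt (x := 1))
  have h4 := ((evalAt v).hasFDerivAt (x := ρ.toHom (g⁻¹ * 1 * g))).hasMFDerivAt.comp (1 : G) h1
  have h5 : (evalAt v ∘ fun h => ρ.toHom (g⁻¹ * h * g)) = fun h => Ψ (ρ.toHom h) := by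
    ext h; simp [Ψ]
  rw [h5] at h4
  have h6 := DFunLike.congr_fun (hasMFDerivAt_unique h3 h4) X
  have h7 : g⁻¹ * 1 * g = 1 := by simp
  have h8 : ρ.toHom g⁻¹ (ρ.differential X (ρ.toHom g v)) =
      ρ.differential (mfderiv I I (fun h : G => g⁻¹ * h * g) 1 X) v := by
    refine h6.trans ?_
    simp only [differential]
    change (show V →L[ℂ] V from mfderiv I 𝓘(ℝ, V →L[ℂ] V) (fun g => ρ.toHom g) (g⁻¹ * 1 * g)
        (mfderiv I I (fun h : G => g⁻¹ * h * g) 1 X)) v = _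
    rw [h7]
    rfl
  rw [← h8]
  have := ρ.toHom_inv_apply g⁻¹ (ρ.differential X (ρ.toHom g v))
  rw [inv_inv] at this
  exact this.symm

/-- Differentiate ρ(gh) = ρ(g) ρ(h) in h at 1. -/
theorem differential_mulInvariantVectorField (ρ : UnitaryRep I G V) (X : GroupLieAlgebra I G)
    (g : G) :
    (mfderiv I 𝓘(ℝ, V →L[ℂ] V) (fun g => ρ.toHom g) g (mulInvariantVectorField X g) : V →L[ℂ] V) =
      ρ.toHom g * ρ.differential X := by
  have hc : MDifferentiableAt I I (fun h : G => g * h) 1 :=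
    (contMDiff_mul_left (I := I) (n := ∞) (a := g) 1).mdifferentiableAt (by simp)
  have h1 : HasMFDerivAt I 𝓘(ℝ, V →L[ℂ] V) (fun h => ρ.toHom (g * h)) 1
      (mfderiv I 𝓘(ℝ, V →L[ℂ] V) (fun g => ρ.toHom g) (g * 1) ∘L
        mfderiv I I (fun h : G => g * h) 1) :=
    (ρ.mdifferentiableAt_toHom (g * 1)).hasMFDerivAt.comp (1 : G) hc.hasMFDerivAt
  let Ψ : (V →L[ℂ] V) →L[ℝ] (V →L[ℂ] V) :=
    ContinuousLinearMap.mul ℝ (V →L[ℂ] V) (ρ.toHom g)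
  have h3 := ρ.hasMFDerivAt_comp_toHom (Ψ.hasFDerivAt (x := 1))
  have h5 : (fun h => ρ.toHom (g * h)) = fun h => Ψ (ρ.toHom h) := by
    ext h; simp [Ψ]
  rw [h5] at h1
  have h6 := DFunLike.congr_fun (hasMFDerivAt_unique h3 h1) X
  refine Eq.trans ?_ h6.symm
  change _ = (mfderiv I 𝓘(ℝ, V →L[ℂ] V) (fun g => ρ.toHom g) (g * 1)
        (mfderiv I I (fun h : G => g * h) 1 X))
  rw [mul_one]
  rfl

open VectorField in
/-- The differential of a representation is a homomorphism of Lie algebras. -/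
theorem differential_lie [CompleteSpace F] (ρ : UnitaryRep I G V) (X Y : GroupLieAlgebra I G) :
    ρ.differential ⁅X, Y⁆ =
      ρ.differential X * ρ.differential Y - ρ.differential Y * ρ.differential X := by
  have : IsManifold I ∞ G := ContMDiffMul.toIsManifold
  have : IsManifold I 1 G := IsManifold.of_le (n := ∞) (by norm_cast)
  have : IsManifold I 2 G := IsManifold.of_le (n := ∞) (by norm_cast)
  let φ := extChartAt I (1 : G)
  let f : F → (V →L[ℂ] V) := fun y => ρ.toHom (φ.symm y)
  let W : GroupLieAlgebra I G → F → F := fun X =>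
    mpullbackWithin 𝓘(ℝ, F) I φ.symm (mulInvariantVectorField X) (Set.range I)
  have hU : UniqueDiffOn ℝ (Set.range I) := I.uniqueDiffOn
  have hφ : φ.symm (φ 1) = 1 := extChartAt_to_inv 1
  have hmem : φ 1 ∈ φ.target := mem_extChartAt_target 1
  have hφr : φ 1 ∈ Set.range I := extChartAt_target_subset_range 1 hmem
  have hf : ∀ y ∈ φ.target, ∀ v : F, fderivWithin ℝ f (Set.range I) y v =
      mfderiv I 𝓘(ℝ, V →L[ℂ] V) (fun g => ρ.toHom g) (φ.symm y)
        (mfderivWithin 𝓘(ℝ, F) I φ.symm (Set.range I) y v) := by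
    intro y hy v
    have h1 : HasMFDerivWithinAt 𝓘(ℝ, F) I φ.symm (Set.range I) y
        (mfderivWithin 𝓘(ℝ, F) I φ.symm (Set.range I) y) :=
      (mdifferentiableWithinAt_extChartAt_symm hy).hasMFDerivWithinAt
    have h2 := (ρ.mdifferentiableAt_toHom (φ.symm y)).hasMFDerivAt.comp_hasMFDerivWithinAt y h1
    let D : F →L[ℝ] (V →L[ℂ] V) := (show F →L[ℝ] (V →L[ℂ] V) from
      mfderiv I 𝓘(ℝ, V →L[ℂ] V) (fun g => ρ.toHom g) (φ.symm y)) ∘L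
        (show F →L[ℝ] F from mfderivWithin 𝓘(ℝ, F) I φ.symm (Set.range I) y)
    have h3 : HasFDerivWithinAt f D (Set.range I) y := h2.hasFDerivWithinAt
    rw [h3.fderivWithin (hU y (extChartAt_target_subset_range 1 hy))]
    rfl
  have hW : ∀ X, ∀ y ∈ φ.target,
      fderivWithin ℝ f (Set.range I) y (W X y) = f y * ρ.differential X := by
    intro X y hy
    rw [hf y hy]
    have hinv : (mfderivWithin 𝓘(ℝ, F) I φ.symm (Set.range I) y).IsInvertible :=
      isInvertible_mfderivWithin_extChartAt_symm hy
    have : mfderivWithin 𝓘(ℝ, F) I φ.symm (Set.range I) y (W X y) =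
        mulInvariantVectorField X (φ.symm y) :=
      hinv.self_apply_inverse _
    rw [this]
    exact ρ.differential_mulInvariantVectorField X (φ.symm y)
  have hWd : ∀ X, DifferentiableWithinAt ℝ (W X) (Set.range I) (φ 1) := by
    intro X
    have h := (mdifferentiableAt_mulInvariantVectorField (I := I) (G := G) X
      (g := 1)).mdifferentiableWithinAt (s := Set.univ)
    have h2 := h.differentiableWithinAt_mpullbackWithin_vectorField
    rwa [Set.preimage_univ, Set.univ_inter] at h2
  have hfc : ContDiffWithinAt ℝ ∞ f (Set.range I) (φ 1) := by
    have h1 : ContMDiffWithinAt 𝓘(ℝ, F) I ∞ φ.symm (Set.range I) (φ 1) :=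
      contMDiffWithinAt_extChartAt_symm_range 1 hmem
    exact ((ρ.smooth _).comp_contMDiffWithinAt (φ 1) h1).contDiffWithinAt
  have hnhds : φ.target ∈ nhdsWithin (φ 1) (Set.range I) := extChartAt_target_mem_nhdsWithin 1
  have hfd : DifferentiableWithinAt ℝ f (Set.range I) (φ 1) :=
    hfc.differentiableWithinAt (by simp)
  -- In the chart, f has derivative f · dρ(Y) along the left-invariant field `W Y`. Differentiating
  -- again along `W X`, where f = 1, gives dρ(X) dρ(Y); the bracket is the antisymmetrization.
  have hsnd : ∀ X Y, fderivWithin ℝ (fun y => fderivWithin ℝ f (Set.range I) y (W Y y))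
      (Set.range I) (φ 1) (W X (φ 1)) = ρ.differential X * ρ.differential Y := by
    intro X Y
    have h1 : fderivWithin ℝ (fun y => fderivWithin ℝ f (Set.range I) y (W Y y))
        (Set.range I) (φ 1) = fderivWithin ℝ (fun y => f y * ρ.differential Y)
        (Set.range I) (φ 1) := by
      refine Filter.EventuallyEq.fderivWithin_eq ?_ (hW Y _ hmem)
      filter_upwards [hnhds] with y hy using hW Y y hy
    rw [h1, fderivWithin_mul_const' (hU _ hφr) hfd]
    have h2 := hW X _ hmem
    have h3 : f (φ 1) = 1 := by simp only [f, hφ, map_one]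
    rw [h3, one_mul] at h2
    simp [h2]
  have key := fderivWithin_apply_lieBracket (n := ∞) hfc
    (by rw [minSmoothness_of_isRCLikeNormedField]; norm_cast) hU
    (I.range_subset_closure_interior hφr)
    hφr (hWd Y) (hWd X)
  rw [hsnd, hsnd] at key
  rw [← key, hf _ hmem]
  have e1 : ∀ w : F, (show F →L[ℝ] F from mfderiv I 𝓘(ℝ, F) φ 1).inverse w = w := by
    intro w
    have h : (show F →L[ℝ] F from mfderiv I 𝓘(ℝ, F) φ 1) = ContinuousLinearMap.id ℝ F :=
      mfderiv_extChartAt_self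
    rw [h, ContinuousLinearMap.inverse_id]
    rfl
  have e2 : ∀ w : F, (show F →L[ℝ] F from
      mfderivWithin 𝓘(ℝ, F) I φ.symm (Set.range I) (φ 1)) w = w :=
    fun w => DFunLike.congr_fun (mfderivWithin_range_extChartAt_symm (I := I) (x := (1 : G))) w
  have hb : (⁅X, Y⁆ : GroupLieAlgebra I G) =
      lieBracketWithin ℝ (W X) (W Y) (Set.range I) (φ 1) := by
    refine (e1 _).trans ?_
    rw [Set.preimage_univ, Set.univ_inter]
  rw [hb]
  refine Eq.trans ?_ (congrArg (show F →L[ℝ] (V →L[ℂ] V) from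
      mfderiv I 𝓘(ℝ, V →L[ℂ] V) (fun g => ρ.toHom g) (φ.symm (φ 1))) (e2 _).symm)
  rw [hφ]
  rfl

end LieGroup

end UnitaryRep

/-! ### Simultaneous diagonalization of commutators -/

section Algebra

variable {V : Type*} [NormedAddCommGroup V] [InnerProductSpace ℂ V] [FiniteDimensional ℂ V]

theorem trace_adjoint_mul_self (A : V →ₗ[ℂ] V) :
    LinearMap.trace ℂ V (LinearMap.adjoint A * A) =
      ((∑ i, ‖A (stdOrthonormalBasis ℂ V i)‖ ^ 2 : ℝ) : ℂ) := by
  rw [LinearMap.trace_eq_sum_inner _ (stdOrthonormalBasis ℂ V)]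
  push_cast
  refine Finset.sum_congr rfl fun i _ => ?_
  rw [Module.End.mul_apply, LinearMap.adjoint_inner_right, inner_self_eq_norm_sq_to_K]
  rfl

/-- Operators that are intertwined, by an embedding into `End V`, with commutators with commuting
symmetric operators, are simultaneously diagonalizable. -/
theorem iSup_iInf_eigenspace_eq_top_of_commutator {M : Type*} [AddCommGroup M] [Module ℝ M]
    [FiniteDimensional ℝ M] (Φ : M →ₗ[ℝ] (V →ₗ[ℂ] V)) (hΦ : Function.Injective Φ) {ι : Type*}
    (T : ι → M →ₗ[ℝ] M) (S : ι → V →ₗ[ℂ] V) (hS : ∀ i, LinearMap.adjoint (S i) = S i)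
    (hSS : ∀ i j, S i * S j = S j * S i)
    (hTS : ∀ i z, Φ (T i z) = S i * Φ z - Φ z * S i) :
    ⨆ χ : ι → ℝ, ⨅ i, Module.End.eigenspace (T i) (χ i) = ⊤ := by
  -- The Hilbert–Schmidt product Re tr(A* B), pulled back along the injection `Φ`. Commutators with
  -- symmetric operators are symmetric for it by cyclicity of the trace.
  let core : InnerProductSpace.Core ℝ M :=
    { inner := fun z w => (LinearMap.trace ℂ V (LinearMap.adjoint (Φ z) * Φ w)).re
      conj_inner_symm := fun z w => by
        have h : LinearMap.adjoint (Φ z) * Φ w = LinearMap.adjoint (LinearMap.adjoint (Φ w) * Φ z) := by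
          ext v; refine ext_inner_left ℂ fun u => ?_
          simp [LinearMap.adjoint_inner_right, LinearMap.adjoint_inner_left]
        have h2 : ∀ A : V →ₗ[ℂ] V, (LinearMap.trace ℂ V (LinearMap.adjoint A)).re =
            (LinearMap.trace ℂ V A).re := by
          intro A
          rw [LinearMap.trace_eq_sum_inner _ (stdOrthonormalBasis ℂ V),
            LinearMap.trace_eq_sum_inner _ (stdOrthonormalBasis ℂ V), Complex.re_sum,
            Complex.re_sum]
          refine Finset.sum_congr rfl fun i _ => ?_
          rw [LinearMap.adjoint_inner_right, ← inner_conj_symm, Complex.conj_re]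
        simp only [h, h2, conj_trivial]
      re_inner_nonneg := fun z => by
        simp only [trace_adjoint_mul_self, Complex.ofReal_re]
        simp only [RCLike.re_to_real]
        positivity
      add_left := fun x y z => by
        simp [add_mul]
      smul_left := fun x y r => by
        have h : LinearMap.adjoint (r • Φ x) = r • LinearMap.adjoint (Φ x) := by
          ext v; refine ext_inner_left ℂ fun u => ?_
          simp [LinearMap.adjoint_inner_right, ← Complex.coe_smul, inner_smul_left,
            inner_smul_right]
        simp only [map_smul, h, smul_mul_assoc, conj_trivial]
        rw [← Complex.coe_smul, map_smul]
        simp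
      definite := fun z hz => by
        have hz : (LinearMap.trace ℂ V (LinearMap.adjoint (Φ z) * Φ z)).re = 0 := hz
        rw [trace_adjoint_mul_self, Complex.ofReal_re,
          Finset.sum_eq_zero_iff_of_nonneg (fun _ _ => by positivity)] at hz
        have h0 : Φ z = 0 := by
          refine (stdOrthonormalBasis ℂ V).toBasis.ext fun i => ?_
          have := hz i (Finset.mem_univ i)
          simpa using this
        exact hΦ (by rw [h0, map_zero]) }
  let : NormedAddCommGroup M := core.toNormedAddCommGroup
  let : InnerProductSpace ℝ M := InnerProductSpace.ofCore core.toCore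
  refine LinearMap.IsSymmetric.iSup_iInf_eq_top_of_commute (fun i z w => ?_) (fun i j _ => ?_)
  · change (LinearMap.trace ℂ V (LinearMap.adjoint (Φ (T i z)) * Φ w)).re =
      (LinearMap.trace ℂ V (LinearMap.adjoint (Φ z) * Φ (T i w))).re
    rw [hTS, hTS]
    have h : LinearMap.adjoint (S i * Φ z - Φ z * S i) =
        LinearMap.adjoint (Φ z) * S i - S i * LinearMap.adjoint (Φ z) := by
      rw [map_sub]
      have hm : ∀ A B : V →ₗ[ℂ] V, LinearMap.adjoint (A * B) =
        LinearMap.adjoint B * LinearMap.adjoint A := fun A B => LinearMap.adjoint_comp A B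
      rw [hm, hm, hS]
    rw [h, sub_mul, mul_sub, map_sub, map_sub, mul_assoc, mul_assoc,
      LinearMap.trace_mul_comm ℂ (S i) (_ * _), mul_assoc]
  · refine LinearMap.ext fun z => hΦ ?_
    rw [Module.End.mul_apply, Module.End.mul_apply, hTS, hTS, hTS, hTS]
    have := hSS i j
    simp only [mul_sub, sub_mul, mul_assoc, this]
    simp only [← mul_assoc, this]
    abel

end Algebra

/-! ### Root decomposition of the complexified Lie algebra -/

section Algebra

/-- The largest complex subspace contained in a real subspace. -/
def complexPart {V : Type*} [AddCommGroup V] [Module ℂ V] [Module ℝ V] [IsScalarTower ℝ ℂ V]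
    (S : Submodule ℝ V) : Submodule ℂ V where
  carrier := {v | v ∈ S ∧ Complex.I • v ∈ S}
  add_mem' := fun ha hb => ⟨S.add_mem ha.1 hb.1, by rw [smul_add]; exact S.add_mem ha.2 hb.2⟩
  zero_mem' := ⟨S.zero_mem, by rw [smul_zero]; exact S.zero_mem⟩
  smul_mem' := by
    rintro c v ⟨h1, h2⟩
    have hr : ∀ (r : ℝ) (w : V), ((r : ℂ)) • w = r • w := fun r w => by
      rw [← algebraMap_smul ℂ r w]; rfl
    have hc : c • v = c.re • v + c.im • (Complex.I • v) := by
      rw [← hr, ← hr, smul_smul, ← add_smul, Complex.re_add_im]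
    have hc' : Complex.I • c • v = c.re • (Complex.I • v) - c.im • v := by
      rw [← hr, ← hr, smul_smul, smul_smul, ← sub_smul]
      congr 1
      apply Complex.ext <;> simp
    refine ⟨?_, ?_⟩
    · rw [hc]; exact S.add_mem (S.smul_mem _ h1) (S.smul_mem _ h2)
    · rw [hc']; exact S.sub_mem (S.smul_mem _ h2) (S.smul_mem _ h1)

variable {L : Type*} [LieRing L] [LieAlgebra ℝ L]

theorem exists_eq_ctmul_add (z : Complexification L) :
    ∃ A B : L, z = ctmul 1 A + Complex.I • ctmul 1 B := by
  induction z using TensorProduct.induction_on with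
  | zero => exact ⟨0, 0, by simp [ctmul]⟩
  | tmul c x =>
    refine ⟨c.re • x, c.im • x, ?_⟩
    simp only [ctmul, TensorProduct.tmul_smul, TensorProduct.smul_tmul', smul_eq_mul,
      ← TensorProduct.add_tmul]
    congr 1
    apply Complex.ext <;> simp
  | add x y hx hy =>
    obtain ⟨A, B, rfl⟩ := hx
    obtain ⟨A', B', rfl⟩ := hy
    refine ⟨A + A', B + B', ?_⟩
    simp only [ctmul, TensorProduct.tmul_add, smul_add]
    abel

theorem lie_ctmul_add (h A B : L) :
    ⁅ctmul 1 h, ctmul 1 A + Complex.I • ctmul 1 B⁆ =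
      ctmul 1 ⁅h, A⁆ + Complex.I • ctmul 1 ⁅h, B⁆ := by
  simp [ctmul, LieAlgebra.ExtendScalars.bracket_tmul]

/-- Adjoining `A` to `t` gives an abelian subalgebra, so maximality applies. -/
theorem mem_of_forall_lie_eq_zero {t : LieSubalgebra ℝ L} (ht : IsMaximalAbelian t) {A : L}
    (hA : ∀ h : t, ⁅(h : L), A⁆ = 0) : A ∈ t := by
  have hab : ∀ x ∈ t, ∀ y ∈ t, ⁅x, y⁆ = 0 := by
    intro x hx y hy
    have := ht.prop.trivial ⟨x, hx⟩ ⟨y, hy⟩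
    exact congrArg Subtype.val this
  have hz : ∀ x ∈ t.toSubmodule ⊔ ℝ ∙ A, ∀ y ∈ t.toSubmodule ⊔ ℝ ∙ A, ⁅x, y⁆ = 0 := by
    intro x hx y hy
    obtain ⟨a, ha, b, hb, rfl⟩ := Submodule.mem_sup.1 hx
    obtain ⟨a', ha', b', hb', rfl⟩ := Submodule.mem_sup.1 hy
    obtain ⟨r, rfl⟩ := Submodule.mem_span_singleton.1 hb
    obtain ⟨r', rfl⟩ := Submodule.mem_span_singleton.1 hb'
    have h1 : ⁅A, a'⁆ = 0 := by rw [← lie_skew, hA ⟨a', ha'⟩, neg_zero]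
    simp [hab a ha a' ha', hA ⟨a, ha⟩, h1]
  let s : LieSubalgebra ℝ L :=
    { t.toSubmodule ⊔ ℝ ∙ A with
      lie_mem' := fun {x y} hx hy => by
        rw [hz x hx y hy]; exact Submodule.zero_mem _ }
  have hs : IsLieAbelian s := ⟨fun x y => Subtype.ext (hz x x.2 y y.2)⟩
  have hts : t ≤ s := fun x hx => (le_sup_left : t.toSubmodule ≤ t.toSubmodule ⊔ ℝ ∙ A) hx
  exact ht.le_of_ge hs hts 
    ((le_sup_right : ℝ ∙ A ≤ t.toSubmodule ⊔ ℝ ∙ A) (Submodule.mem_span_singleton_self A))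

variable {V : Type*} [NormedAddCommGroup V] [InnerProductSpace ℂ V]

theorem liftBaseChange_ctmul_add (φ : L →ₗ[ℝ] (V →L[ℂ] V)) (A B : L) :
    LinearMap.liftBaseChange ℂ φ (ctmul 1 A + Complex.I • ctmul 1 B) =
      φ A + Complex.I • φ B := by
  simp [ctmul]

/-- An operator that is both skew-Hermitian (φ A) and Hermitian (-i φ B) vanishes. -/
theorem eq_zero_of_add_I_smul_eq_zero {φ : L →ₗ[ℝ] (V →L[ℂ] V)} (hinj : Function.Injective φ)
    (hskew : ∀ X u v, inner ℂ (φ X u) v = -inner ℂ u (φ X v)) {A B : L}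
    (hz : φ A + Complex.I • φ B = 0) : A = 0 ∧ B = 0 := by
  have h1 : ∀ v, φ A v = -(Complex.I • φ B v) := fun v =>
    eq_neg_of_add_eq_zero_left (by simpa using DFunLike.congr_fun hz v)
  have hA : φ A = 0 := by
    ext v
    refine ext_inner_left ℂ fun u => ?_
    have h2 := hskew A u v
    rw [h1 u, h1 v, inner_neg_left, inner_smul_left, hskew, inner_neg_right, inner_smul_right,
      Complex.conj_I] at h2
    rw [h1 v, inner_neg_right, inner_smul_right, zero_apply, inner_zero_right]
    linear_combination (1 / 2 : ℂ) * h2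
  have hB : φ B = 0 := by
    ext v
    have := h1 v
    rw [hA] at this
    simpa using this.symm
  exact ⟨(injective_iff_map_eq_zero φ).1 hinj A hA, (injective_iff_map_eq_zero φ).1 hinj B hB⟩

theorem liftBaseChange_injective {φ : L →ₗ[ℝ] (V →L[ℂ] V)} (hinj : Function.Injective φ)
    (hskew : ∀ X u v, inner ℂ (φ X u) v = -inner ℂ u (φ X v)) :
    Function.Injective (LinearMap.liftBaseChange ℂ φ) := by
  rw [injective_iff_map_eq_zero]
  intro z hz
  obtain ⟨A, B, rfl⟩ := exists_eq_ctmul_add z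
  rw [liftBaseChange_ctmul_add] at hz
  obtain ⟨rfl, rfl⟩ := eq_zero_of_add_I_smul_eq_zero hinj hskew hz
  simp [ctmul]

theorem ctmul_add_inj {φ : L →ₗ[ℝ] (V →L[ℂ] V)} (hinj : Function.Injective φ)
    (hskew : ∀ X u v, inner ℂ (φ X u) v = -inner ℂ u (φ X v)) {A B A' B' : L}
    (h : ctmul 1 A + Complex.I • ctmul 1 B = ctmul 1 A' + Complex.I • ctmul 1 B') :
    A = A' ∧ B = B' := by
  have h1 := congrArg (LinearMap.liftBaseChange ℂ φ) h
  rw [liftBaseChange_ctmul_add, liftBaseChange_ctmul_add] at h1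
  have h2 : φ (A - A') + Complex.I • φ (B - B') = 0 := by
    rw [map_sub, map_sub, smul_sub]
    rw [← sub_eq_zero.2 h1]
    abel
  obtain ⟨h3, h4⟩ := eq_zero_of_add_I_smul_eq_zero hinj hskew h2
  exact ⟨sub_eq_zero.1 h3, sub_eq_zero.1 h4⟩

theorem liftBaseChange_lie {φ : L →ₗ[ℝ] (V →L[ℂ] V)}
    (hlie : ∀ X Y, φ ⁅X, Y⁆ = φ X * φ Y - φ Y * φ X) (h : L) (z : Complexification L) :
    LinearMap.liftBaseChange ℂ φ ⁅ctmul 1 h, z⁆ =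
      φ h * LinearMap.liftBaseChange ℂ φ z - LinearMap.liftBaseChange ℂ φ z * φ h := by
  obtain ⟨A, B, rfl⟩ := exists_eq_ctmul_add z
  rw [lie_ctmul_add, liftBaseChange_ctmul_add, liftBaseChange_ctmul_add, hlie, hlie]
  simp only [mul_add, add_mul, smul_sub, mul_smul_comm, smul_mul_assoc]
  abel

variable [FiniteDimensional ℝ L] [FiniteDimensional ℂ V]

/-- The complexification is spanned by the joint eigenspaces of the operators `i ad h`, `h ∈ t`. -/
theorem iSup_iInf_eigenspace_ad_eq_top {φ : L →ₗ[ℝ] (V →L[ℂ] V)} (hinj : Function.Injective φ)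
    (hlie : ∀ X Y, φ ⁅X, Y⁆ = φ X * φ Y - φ Y * φ X)
    (hskew : ∀ X u v, inner ℂ (φ X u) v = -inner ℂ u (φ X v))
    {t : LieSubalgebra ℝ L} (ht : IsMaximalAbelian t) (T : t → Complexification L →ₗ[ℝ] Complexification L)
    (hT : ∀ h z, T h z = Complex.I • ⁅ctmul 1 (h : L), z⁆) :
    ⨆ χ : t → ℝ, ⨅ h, Module.End.eigenspace (T h) (χ h) = ⊤ := by
  let ψ : (V →L[ℂ] V) →ₗ[ℝ] (V →ₗ[ℂ] V) :=
    { toFun := fun A => A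
      map_add' := fun _ _ => rfl
      map_smul' := fun _ _ => rfl }
  refine iSup_iInf_eigenspace_eq_top_of_commutator
    (ψ ∘ₗ (LinearMap.liftBaseChange ℂ φ).restrictScalars ℝ) ?_ T
    (fun h => ((Complex.I • φ h : V →L[ℂ] V) : V →ₗ[ℂ] V)) ?_ ?_ ?_
  · exact ContinuousLinearMap.coe_injective.comp (liftBaseChange_injective hinj hskew)
  · intro h
    refine LinearMap.ext fun v => ext_inner_left ℂ fun u => ?_
    rw [LinearMap.adjoint_inner_right]
    simp [inner_smul_left, inner_smul_right, hskew]
  · intro h k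
    have h1 := hlie h k
    have h2 : ⁅(h : L), (k : L)⁆ = 0 := congrArg Subtype.val (ht.prop.trivial h k)
    rw [h2, map_zero] at h1
    refine LinearMap.ext fun v => ?_
    have := DFunLike.congr_fun (sub_eq_zero.1 h1.symm) v
    simp only [mul_apply_eq_comp] at this
    simp [this]
  · intro h z
    refine LinearMap.ext fun v => ?_
    have := DFunLike.congr_fun (liftBaseChange_lie hlie h z) v
    simp only [LinearMap.comp_apply, LinearMap.restrictScalars_apply, hT, map_smul, ψ]
    change Complex.I • (LinearMap.liftBaseChange ℂ φ _) v = _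
    rw [this]
    simp [smul_sub]

/-- The complexified Lie algebra maps a highest weight vector `p` to the sum of `ℂ p` and the
largest complex subspace of the tangent space of the orbit of `p`. -/
theorem exists_liftBaseChange_apply_eq {φ : L →ₗ[ℝ] (V →L[ℂ] V)} (hinj : Function.Injective φ)
    (hlie : ∀ X Y, φ ⁅X, Y⁆ = φ X * φ Y - φ Y * φ X)
    (hskew : ∀ X u v, inner ℂ (φ X u) v = -inner ℂ u (φ X v))
    {t : LieSubalgebra ℝ L} (ht : IsMaximalAbelian t) {P : Set (t → ℂ)} (hP : IsPositiveSystem t P)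
    {p : V} {l : t → ℂ} (hl : ∀ h : t, φ h p = l h • p)
    (hp : ∀ α ∈ P, ∀ z ∈ rootSpace t α, LinearMap.liftBaseChange ℂ φ z p = 0)
    (S : Submodule ℝ V) (hS : ∀ X, φ X p ∈ S) (z : Complexification L) :
    ∃ c : ℂ, ∃ n ∈ complexPart S, LinearMap.liftBaseChange ℂ φ z p = c • p + n := by
  let T : t → Complexification L →ₗ[ℝ] Complexification L := fun h =>
    { toFun := fun z => Complex.I • ⁅ctmul 1 (h : L), z⁆
      map_add' := fun x y => by rw [lie_add, smul_add]
      map_smul' := fun r x => by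
        have : ∀ y : Complexification L, r • y = (r : ℂ) • y := fun y =>
          (algebraMap_smul ℂ r y).symm
        rw [RingHom.id_apply, this, lie_smul, smul_comm, this] }
  have htop := iSup_iInf_eigenspace_ad_eq_top hinj hlie hskew ht T fun _ _ => rfl
  have hz : z ∈ ⨆ χ : t → ℝ, ⨅ h, Module.End.eigenspace (T h) (χ h) := htop ▸ Submodule.mem_top
  induction hz using Submodule.iSup_induction' with
  | zero => exact ⟨0, 0, Submodule.zero_mem _, by simp⟩
  | add x y _ _ hx hy =>
    obtain ⟨c, n, hn, h1⟩ := hx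
    obtain ⟨c', n', hn', h2⟩ := hy
    refine ⟨c + c', n + n', Submodule.add_mem _ hn hn', ?_⟩
    rw [map_add, add_apply, h1, h2, add_smul]
    abel
  | mem χ z hz =>
    -- The real eigenvalues χ belong to i ad h, so the weight of ad h is -iχ.
    let α : t → ℂ := fun h => -(Complex.I * χ h)
    have hα : z ∈ rootSpace t α := by
      intro h
      have h1 : Complex.I • ⁅ctmul 1 (h : L), z⁆ = (χ h : ℂ) • z := by
        have := Module.End.mem_eigenspace_iff.1 ((Submodule.mem_iInf _).1 hz h)
        exact this.trans (algebraMap_smul ℂ (χ h) z).symm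
      have h2 := congrArg (fun w => (-Complex.I) • w) h1
      simp only [smul_smul] at h2
      simpa [α] using h2
    -- Weight zero: the real and imaginary parts commute with `t`, hence lie in it, and act on `p`
    -- by scalars.
    by_cases h0 : α = 0
    · obtain ⟨A, B, rfl⟩ := exists_eq_ctmul_add z
      have h1 : ∀ h : t, ⁅(h : L), A⁆ = 0 ∧ ⁅(h : L), B⁆ = 0 := by
        intro h
        have := hα h
        rw [lie_ctmul_add, h0] at this
        refine ctmul_add_inj hinj hskew (this.trans ?_)
        simp [ctmul]
      have hA := mem_of_forall_lie_eq_zero ht fun h => (h1 h).1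
      have hB := mem_of_forall_lie_eq_zero ht fun h => (h1 h).2
      refine ⟨l ⟨A, hA⟩ + Complex.I * l ⟨B, hB⟩, 0, Submodule.zero_mem _, ?_⟩
      have e1 := hl ⟨A, hA⟩
      have e2 := hl ⟨B, hB⟩
      simp only at e1 e2
      rw [liftBaseChange_ctmul_add]
      simp [e1, e2, add_smul, smul_smul]
    by_cases hαP : α ∈ P
    · exact ⟨0, 0, Submodule.zero_mem _, by simp [hp α hαP z hα]⟩
    by_cases hz0 : z = 0
    · exact ⟨0, 0, Submodule.zero_mem _, by simp [hz0]⟩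
    have hroot : α ∈ roots t := ⟨h0, fun hbot => hz0 (by rw [hbot] at hα; simpa using hα)⟩
    have hneg : -α ∈ P := by
      by_contra hneg
      exact hαP ((hP.mem_iff α hroot).2 hneg)
    -- Only negative roots remain. Conjugation takes A + iB to A - iB, of weight -α since weights
    -- are imaginary on `t`. That vector kills `p`, so (A + iB) p is the value 2 A p of a real Lie
    -- algebra element.
    have hw : ∀ w ∈ rootSpace t α, LinearMap.liftBaseChange ℂ φ w p ∈ S := by
      intro w hw
      obtain ⟨A, B, rfl⟩ := exists_eq_ctmul_add w
      have h1 : ∀ h : t, ⁅(h : L), A⁆ = χ h • B ∧ ⁅(h : L), B⁆ = -(χ h • A) := by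
        intro h
        have := hw h
        rw [lie_ctmul_add] at this
        refine ctmul_add_inj hinj hskew (this.trans ?_)
        have hr : ∀ x : L, ctmul 1 (χ h • x) = (χ h : ℂ) • ctmul 1 x := fun x => by
          rw [ctmul, TensorProduct.tmul_smul]
          exact (algebraMap_smul ℂ (χ h) _).symm
        have hn : ∀ x : L, ctmul 1 (-x) = -ctmul 1 x := fun x => TensorProduct.tmul_neg _ _
        rw [hn, hr, hr]
        simp only [α, smul_add, smul_smul, ← neg_smul]
        rw [add_comm]
        congr 2
        · linear_combination (-χ h : ℂ) * Complex.I_mul_I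
        · ring
      have hconj : ctmul 1 A + Complex.I • ctmul 1 (-B) ∈ rootSpace t (-α) := by
        intro h
        rw [lie_ctmul_add, lie_neg, (h1 h).1, (h1 h).2, neg_neg]
        have hr : ∀ x : L, ctmul 1 (χ h • x) = (χ h : ℂ) • ctmul 1 x := fun x => by
          rw [ctmul, TensorProduct.tmul_smul]
          exact (algebraMap_smul ℂ (χ h) _).symm
        have hn : ∀ x : L, ctmul 1 (-x) = -ctmul 1 x := fun x => TensorProduct.tmul_neg _ _
        rw [hn, hr, hr]
        simp only [α, smul_add, smul_smul, Pi.neg_apply, neg_neg]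
        rw [add_comm, smul_neg, ← neg_smul]
        congr 2
        linear_combination (χ h : ℂ) * Complex.I_mul_I
      have h2 := hp _ hneg _ hconj
      rw [liftBaseChange_ctmul_add] at h2 ⊢
      have h3 : φ A p = Complex.I • φ B p := by
        simp only [map_neg, smul_neg] at h2
        exact sub_eq_zero.1 (by simpa [sub_eq_add_neg] using h2)
      have h4 : (φ A + Complex.I • φ B) p = φ (A + A) p := by
        simp [h3]
      rw [h4]
      exact hS _
    refine ⟨0, _, ⟨hw z hα, ?_⟩, by rw [zero_smul, zero_add]⟩
    -- Root spaces are complex, so i z p is tangent too.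
    have := hw (Complex.I • z) (Submodule.smul_mem _ _ hα)
    simpa using this

end Algebra

/-! ### Tangent spaces of orbits of highest weight vectors -/

section HighestWeight

namespace UnitaryRep

section General

variable {F : Type*} [NormedAddCommGroup F] [NormedSpace ℝ F] {H : Type*} [TopologicalSpace H]
  {I : ModelWithCorners ℝ F H} {G : Type*} [TopologicalSpace G] [ChartedSpace H G] [Group G]
  {V : Type*} [NormedAddCommGroup V] [InnerProductSpace ℂ V]

theorem re_inner_orbitTangent (ρ : UnitaryRep I G V) {p v : V} (hv : v ∈ ρ.orbitTangent p) :
    (inner ℂ p v).re = 0 := by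
  obtain ⟨X, rfl⟩ := ρ.mem_orbitTangent.1 hv
  have h := congrArg Complex.re (ρ.inner_differential X p p)
  rw [← inner_conj_symm, Complex.conj_re, Complex.neg_re] at h
  linarith

/-- Orbit tangent vectors are real orthogonal to `p`; apply this to both v and iv. -/
theorem inner_complexPart (ρ : UnitaryRep I G V) {p v : V}
    (hv : v ∈ complexPart (ρ.orbitTangent p)) : inner ℂ p v = 0 := by
  have h1 := ρ.re_inner_orbitTangent hv.1
  have h2 := ρ.re_inner_orbitTangent hv.2
  rw [inner_smul_right] at h2
  apply Complex.ext
  · simpa using h1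
  · simpa using h2

/-- Conjugation by the operators `ρ g` preserves the image of the Lie algebra. -/
def ConjInvariant (ρ : UnitaryRep I G V) : Prop :=
  ∀ g X, ∃ X', ∀ v, ρ.differential X (ρ.toHom g v) = ρ.toHom g (ρ.differential X' v)

theorem ConjInvariant.exists_of_mem_orbitTangent {ρ : UnitaryRep I G V} (h : ρ.ConjInvariant)
    {g : G} {p w : V} (hw : w ∈ ρ.orbitTangent (ρ.toHom g p)) :
    ∃ w' ∈ ρ.orbitTangent p, w = ρ.toHom g w' := by
  obtain ⟨X, rfl⟩ := ρ.mem_orbitTangent.1 hw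
  obtain ⟨X', hX'⟩ := h g X
  exact ⟨_, ρ.differential_mem_orbitTangent X' p, hX' p⟩

theorem ConjInvariant.toHom_mem_orbitTangent {ρ : UnitaryRep I G V} (h : ρ.ConjInvariant)
    {p w : V} (hw : w ∈ ρ.orbitTangent p) (g : G) :
    ρ.toHom g w ∈ ρ.orbitTangent (ρ.toHom g p) := by
  obtain ⟨X, rfl⟩ := ρ.mem_orbitTangent.1 hw
  obtain ⟨X', hX'⟩ := h g⁻¹ X
  have h1 := hX' (ρ.toHom g p)
  have h2 := ρ.toHom_inv_apply g⁻¹ (ρ.differential X' (ρ.toHom g p))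
  rw [inv_inv] at h2
  rw [ρ.toHom_inv_apply] at h1
  rw [h1, h2]
  exact ρ.differential_mem_orbitTangent _ _

end General

variable {F : Type*} [NormedAddCommGroup F] [NormedSpace ℝ F] [FiniteDimensional ℝ F]
  [CompleteSpace F]
  {H : Type*} [TopologicalSpace H]
  {I : ModelWithCorners ℝ F H} {G : Type*} [TopologicalSpace G] [ChartedSpace H G] [Group G]
  [LieGroup I ∞ G]
  {V : Type*} [NormedAddCommGroup V] [InnerProductSpace ℂ V] [FiniteDimensional ℂ V]

omit [FiniteDimensional ℝ F] [FiniteDimensional ℂ V] in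
-- The kernel of a Lie algebra homomorphism is an ideal.
theorem differential_injective_or_eq_zero (ρ : UnitaryRep I G V)
    (hs : LieAlgebra.IsSimple ℝ (GroupLieAlgebra I G)) :
    Function.Injective ρ.differential ∨ ∀ X, ρ.differential X = 0 := by
  let N : LieIdeal ℝ (GroupLieAlgebra I G) :=
    { LinearMap.ker ρ.differential.toLinearMap with
      lie_mem := fun {X Y} hY => by
        have hY : ρ.differential Y = 0 := hY
        change ρ.differential ⁅X, Y⁆ = 0
        rw [ρ.differential_lie, hY, mul_zero, zero_mul, sub_zero] }
  rcases hs.eq_bot_or_eq_top N with h | h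
  · left
    refine (injective_iff_map_eq_zero ρ.differential).2 fun X hX => ?_
    have : X ∈ N := hX
    rw [h] at this
    exact (LieSubmodule.mem_bot X).1 this
  · right
    intro X
    have : X ∈ N := h ▸ LieSubmodule.mem_top X
    exact this

/-- The root decomposition applied to 1 ⊗ X. The coefficient of `p` is ⟨p, X p⟩, which is imaginary
because X acts by a skew-Hermitian operator. -/
theorem exists_differential_apply_eq (ρ : UnitaryRep I G V)
    (hs : LieAlgebra.IsSimple ℝ (GroupLieAlgebra I G))
    {t : LieSubalgebra ℝ (GroupLieAlgebra I G)} (ht : IsMaximalAbelian t) {P : Set (t → ℂ)}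
    (hP : IsPositiveSystem t P) {p : V} (hp : ρ.IsHighestWeightVector t P p) (hp1 : ‖p‖ = 1)
    (X : GroupLieAlgebra I G) :
    ∃ r : ℝ, ∃ n ∈ complexPart (ρ.orbitTangent p),
      ρ.differential X p = ((r : ℂ) * Complex.I) • p + n := by
  rcases ρ.differential_injective_or_eq_zero hs with hinj | h0
  · obtain ⟨-, ⟨l, hl⟩, hpos⟩ := hp
    have : FiniteDimensional ℝ (GroupLieAlgebra I G) := inferInstanceAs (FiniteDimensional ℝ F)
    obtain ⟨c, n, hn, h⟩ := exists_liftBaseChange_apply_eq (φ := ρ.differential.toLinearMap)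
      hinj ρ.differential_lie ρ.inner_differential ht hP hl hpos (ρ.orbitTangent p)
      (fun X => ρ.differential_mem_orbitTangent X p) (ctmul 1 X)
    have h' : ρ.differential X p = c • p + n := by
      rw [← h]; simp [ctmul]
    have h2 : inner ℂ p (ρ.differential X p) = c := by
      rw [h', inner_add_right, inner_smul_right, ρ.inner_complexPart hn,
        inner_self_eq_norm_sq_to_K, hp1]
      simp
    have h3 := ρ.re_inner_orbitTangent (ρ.differential_mem_orbitTangent X p)
    rw [h2] at h3
    refine ⟨c.im, n, hn, ?_⟩
    rw [h']
    congr 2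
    apply Complex.ext <;> simp [h3]
  · exact ⟨0, 0, Submodule.zero_mem _, by simp [h0]⟩

omit [FiniteDimensional ℝ F] [FiniteDimensional ℂ V] in
-- If some r is nonzero, subtracting n exhibits a nonzero real multiple of ip as tangent. Otherwise
-- the tangent space is complex and orthogonal to `p`: choosing Y with Y p = i X p gives 0 = ⟨p, [X,
-- Y] p⟩ = -2i ‖X p‖², so every X p vanishes.
theorem orbitTangent_eq_bot_or_I_smul_mem (ρ : UnitaryRep I G V) {p : V}
    (h : ∀ X, ∃ r : ℝ, ∃ n ∈ complexPart (ρ.orbitTangent p),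
      ρ.differential X p = ((r : ℂ) * Complex.I) • p + n) :
    ρ.orbitTangent p = ⊥ ∨ Complex.I • p ∈ ρ.orbitTangent p := by
  by_cases hr : ∃ X, ∃ r : ℝ, r ≠ 0 ∧ ∃ n ∈ complexPart (ρ.orbitTangent p),
      ρ.differential X p = ((r : ℂ) * Complex.I) • p + n
  · right
    obtain ⟨X, r, hr, n, hn, hX⟩ := hr
    have h1 : (r : ℂ) • Complex.I • p ∈ ρ.orbitTangent p := by
      rw [smul_smul, ← add_sub_cancel_right (((r : ℂ) * Complex.I) • p) n, ← hX]
      exact Submodule.sub_mem _ (ρ.differential_mem_orbitTangent X p) hn.1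
    rw [Complex.coe_smul] at h1
    exact (Submodule.smul_mem_iff _ hr).1 h1
  · left
    have hc : ∀ X, ρ.differential X p ∈ complexPart (ρ.orbitTangent p) := by
      intro X
      obtain ⟨r, n, hn, hX⟩ := h X
      have : r = 0 := by
        by_contra h0
        exact hr ⟨X, r, h0, n, hn, hX⟩
      rw [hX, this]
      simpa using hn
    rw [eq_bot_iff]
    intro v hv
    obtain ⟨X, rfl⟩ := ρ.mem_orbitTangent.1 hv
    obtain ⟨Y, hY⟩ := ρ.mem_orbitTangent.1 (hc X).2
    have h1 := ρ.inner_complexPart (hc ⁅X, Y⁆)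
    rw [ρ.differential_lie, sub_apply, mul_apply_eq_comp, mul_apply_eq_comp, inner_sub_right] at h1
    have h2 := ρ.inner_differential X p (ρ.differential Y p)
    have h3 := ρ.inner_differential Y p (ρ.differential X p)
    rw [hY, inner_smul_right] at h2
    rw [hY, inner_smul_left, Complex.conj_I] at h3
    have h4 : inner ℂ (ρ.differential X p) (ρ.differential X p) = 0 := by
      have : Complex.I * inner ℂ (ρ.differential X p) (ρ.differential X p) = 0 := by
        rw [hY] at h1
        linear_combination (1 / 2 : ℂ) * (h2 - h3 - h1)
      simpa using this
    simpa using h4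

end UnitaryRep

end HighestWeight

/-! ### The second fundamental form through linear tangent fields -/

section SecondFundamentalForm

attribute [local instance] InnerProductSpace.complexToReal

namespace UnitaryRep

variable {F : Type*} [NormedAddCommGroup F] [NormedSpace ℝ F] {H : Type*} [TopologicalSpace H]
  {I : ModelWithCorners ℝ F H} {G : Type*} [TopologicalSpace G] [ChartedSpace H G] [Group G]
  {V : Type*} [NormedAddCommGroup V] [InnerProductSpace ℂ V] [FiniteDimensional ℂ V]

omit [FiniteDimensional ℂ V] in
/-- A tangent field that vanishes at `p` has no normal derivative at `p`. -/
theorem fderiv_mem_orthogonal_normalSpace (ρ : UnitaryRep I G V) {p : V}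
    (hconj : ρ.ConjInvariant)
    {Y : V → V} (hY : IsTangentField (ρ.orbit p) ρ.orbitTangent Y) (h0 : Y p = 0) {u : V}
    (hu : u ∈ ρ.orbitTangent p) : fderiv ℝ Y p u ∈ (normalSpace (ρ.orbitTangent p) p)ᗮ := by
  obtain ⟨X, rfl⟩ := ρ.mem_orbitTangent.1 hu
  rw [Submodule.mem_orthogonal]
  intro n hn
  have hYd : HasFDerivAt Y (fderiv ℝ Y p) (evalAt p (1 : V →L[ℂ] V)) :=
    (hY.contDiff.differentiable (by simp) p).hasFDerivAt
  -- The function ⟨g n, Y(g p)⟩ vanishes on the group because Y(g p) lies in g T_p. Its derivative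
  -- at 1 is ⟨X n, Y p⟩ + ⟨n, dY(X p)⟩, and Y p = 0.
  have h1 := ((evalAt n).hasFDerivAt (x := 1)).inner ℝ
    (hYd.comp (1 : V →L[ℂ] V) ((evalAt p).hasFDerivAt (x := 1)))
  have h2 := ρ.apply_differential_eq_zero h1 (c := 0) (fun g => by
    obtain ⟨w', hw', hw⟩ := hconj.exists_of_mem_orbitTangent (hY.mem (ρ.toHom g p) ⟨g, rfl⟩)
    simp only [evalAt_apply, Function.comp_apply]
    rw [hw, real_inner_eq_re_inner ℂ, ρ.inner_map, ← real_inner_eq_re_inner ℂ, real_inner_comm]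
    exact (Submodule.mem_orthogonal _ _).1 hn w' (Submodule.mem_sup_right hw')) X
  simpa [fderivInnerCLM_apply, h0] using h2

/-- Independence of the extension: two tangent fields agreeing at `p` differ by one vanishing there.
This allows the chosen field in the definition to be replaced by a linear one. -/
theorem secondFundForm_eq (ρ : UnitaryRep I G V) {p : V}
    (hconj : ρ.ConjInvariant)
    {Y : V → V} (hY : IsTangentField (ρ.orbit p) ρ.orbitTangent Y) {u : V}
    (hu : u ∈ ρ.orbitTangent p) :
    secondFundForm (ρ.orbit p) ρ.orbitTangent p u (Y p) =
      (normalSpace (ρ.orbitTangent p) p).starProjection (fderiv ℝ Y p u) := by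
  have hex : ∃ Z, IsTangentField (ρ.orbit p) ρ.orbitTangent Z ∧ Z p = Y p := ⟨Y, hY, rfl⟩
  rw [secondFundForm, dif_pos hex]
  obtain ⟨hZ, hZp⟩ := hex.choose_spec
  generalize hex.choose = Z at hZ hZp
  have hd : IsTangentField (ρ.orbit p) ρ.orbitTangent (fun q => Z q - Y q) :=
    ⟨hZ.contDiff.sub hY.contDiff, fun q hq => Submodule.sub_mem _ (hZ.mem q hq) (hY.mem q hq)⟩
  have h1 := ρ.fderiv_mem_orthogonal_normalSpace hconj hd (by simp [hZp]) hu
  rw [fderiv_fun_sub (hZ.contDiff.differentiable (by simp) p)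
    (hY.contDiff.differentiable (by simp) p), sub_apply] at h1
  rw [← sub_eq_zero, ← map_sub]
  exact (Submodule.starProjection_apply_eq_zero_iff _).2 h1

/-- The second fundamental form along the tangent field given by an element of the Lie algebra and
a multiple of the position vector. -/
theorem secondFundForm_differential_add (ρ : UnitaryRep I G V) {p : V}
    (hconj : ρ.ConjInvariant) (X : GroupLieAlgebra I G) {c : ℂ}
    (hc : c • p ∈ ρ.orbitTangent p) {u : V} (hu : u ∈ ρ.orbitTangent p) :
    secondFundForm (ρ.orbit p) ρ.orbitTangent p u (ρ.differential X p + c • p) =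
      (normalSpace (ρ.orbitTangent p) p).starProjection (ρ.differential X u + c • u) := by
  let A : V →L[ℝ] V := (ρ.differential X + c • (1 : V →L[ℂ] V)).restrictScalars ℝ
  have hA : ∀ q, A q = ρ.differential X q + c • q := fun q => by simp [A]
  have := ρ.secondFundForm_eq hconj (Y := A) (p := p) ⟨A.contDiff, ?_⟩ hu
  · rw [ContinuousLinearMap.fderiv, hA, hA] at this
    exact this
  · rintro q ⟨g, rfl⟩
    rw [hA]
    refine Submodule.add_mem _ (ρ.differential_mem_orbitTangent X _) ?_
    change c • ρ.toHom g p ∈ _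
    rw [← map_smul]
    exact hconj.toHom_mem_orbitTangent hc g

theorem norm_starProjection_differential_le (ρ : UnitaryRep I G V) {p : V}
    (hconj : ρ.ConjInvariant) {C : ℝ} (hC0 : 0 ≤ C)
    (hC : ρ.orbitSecondFundNorm p ≤ ENNReal.ofReal C) (X : GroupLieAlgebra I G) {u : V}
    (hu : u ∈ ρ.orbitTangent p) :
    ‖(normalSpace (ρ.orbitTangent p) p).starProjection (ρ.differential X u)‖ ≤
      C * ‖u‖ * ‖ρ.differential X p‖ := by
  have hII : ∀ Z : GroupLieAlgebra I G, ∀ w ∈ ρ.orbitTangent p,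
      secondFundForm (ρ.orbit p) ρ.orbitTangent p w (ρ.differential Z p) =
        (normalSpace (ρ.orbitTangent p) p).starProjection (ρ.differential Z w) := by
    intro Z w hw
    have := ρ.secondFundForm_differential_add hconj Z (c := 0) (p := p)
      (by rw [zero_smul]; exact Submodule.zero_mem _) hw
    simpa only [zero_smul, add_zero] using this
  by_cases hu0 : u = 0
  · simp [hu0]
  by_cases hX0 : ρ.differential X p = 0
  -- Normalization is impossible here. But X and 0 have the same value at `p`, so they give the same
  -- second fundamental form, namely 0.
  · have h1 := hII X u hu
    have h2 := hII 0 u hu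
    rw [map_zero, zero_apply, zero_apply, map_zero] at h2
    rw [← h1, hX0, h2]
    simp
  have hun : ‖u‖ ≠ 0 := norm_ne_zero_iff.2 hu0
  have hXn : ‖ρ.differential X p‖ ≠ 0 := norm_ne_zero_iff.2 hX0
  have hunit : ∀ w : V, ‖w‖ ≠ 0 → ‖(‖w‖⁻¹ : ℝ) • w‖ = 1 := fun w hw => by
    rw [norm_smul, norm_inv, norm_norm, inv_mul_cancel₀ hw]
  have h3 : ‖secondFundForm (ρ.orbit p) ρ.orbitTangent p (‖u‖⁻¹ • u)
      (ρ.differential (‖ρ.differential X p‖⁻¹ • X) p)‖ₑ ≤ ENNReal.ofReal C := by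
    refine le_trans ?_ hC
    refine le_iSup₂_of_le (f := fun (u : V) (_ : u ∈ ρ.orbitTangent p) => _) (‖u‖⁻¹ • u)
      (Submodule.smul_mem _ _ hu) ?_
    refine le_iSup₂_of_le (f := fun (v : V) (_ : v ∈ ρ.orbitTangent p) => _)
      (ρ.differential (‖ρ.differential X p‖⁻¹ • X) p) (ρ.differential_mem_orbitTangent _ _) ?_
    refine le_iSup₂_of_le (f := fun _ _ => _) (hunit u hun) ?_ le_rfl
    rw [map_smul]
    exact hunit _ hXn
  rw [hII _ _ (Submodule.smul_mem _ _ hu), ← ofReal_norm,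
    ENNReal.ofReal_le_ofReal_iff hC0] at h3
  have h4 : ρ.differential (‖ρ.differential X p‖⁻¹ • X) (‖u‖⁻¹ • u) =
      (‖ρ.differential X p‖⁻¹ * ‖u‖⁻¹) • ρ.differential X u := by
    have : ρ.differential X (‖u‖⁻¹ • u) = ‖u‖⁻¹ • ρ.differential X u :=
      ((ρ.differential X).restrictScalars ℝ).map_smul _ _
    rw [ρ.differential.map_smul]
    refine (congrArg (fun w => ‖ρ.differential X p‖⁻¹ • w) this).trans (smul_smul _ _ _)
  rw [h4, map_smul, norm_smul, norm_mul, norm_inv, norm_inv, norm_norm, norm_norm] at h3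
  have h5 := mul_le_mul_of_nonneg_left h3
    (mul_nonneg (norm_nonneg u) (norm_nonneg (ρ.differential X p)))
  have h6 : ‖u‖ * ‖ρ.differential X p‖ * (‖ρ.differential X p‖⁻¹ * ‖u‖⁻¹ *
      ‖(normalSpace (ρ.orbitTangent p) p).starProjection (ρ.differential X u)‖) =
      ‖(normalSpace (ρ.orbitTangent p) p).starProjection (ρ.differential X u)‖ := by
    field_simp
  rw [h6] at h5
  linarith

end UnitaryRep

end SecondFundamentalForm

/-! ### Derivatives on finite products of manifolds -/

section Pi

variable {ι : Type*} [Fintype ι] {E : ι → Type*} [∀ i, NormedAddCommGroup (E i)]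
  [∀ i, NormedSpace ℝ (E i)] {H : ι → Type*} [∀ i, TopologicalSpace (H i)]
  (I : ∀ i, ModelWithCorners ℝ (E i) (H i)) {K : ι → Type*} [∀ i, TopologicalSpace (K i)]
  [∀ i, ChartedSpace (H i) (K i)]

/-- In product charts the projection is the linear coordinate projection. -/
theorem hasMFDerivAt_pi_apply (k : ∀ i, K i) (i : ι) :
    HasMFDerivAt (ModelWithCorners.pi I) (I i) (fun k : ∀ i, K i => k i) k
      (ContinuousLinearMap.proj (R := ℝ) (φ := E) i) := by
  refine ⟨(continuous_apply i).continuousAt, ?_⟩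
  have h : ∀ᶠ y in nhdsWithin (extChartAt (ModelWithCorners.pi I) k k)
        (Set.range (ModelWithCorners.pi I)),
      writtenInExtChartAt (ModelWithCorners.pi I) (I i) k (fun k : ∀ i, K i => k i) y = y i := by
    filter_upwards [extChartAt_target_mem_nhdsWithin (I := ModelWithCorners.pi I) k] with y hy
    exact congrFun ((extChartAt (ModelWithCorners.pi I) k).right_inv hy) i
  refine HasFDerivWithinAt.congr_of_eventuallyEq
    (ContinuousLinearMap.proj (R := ℝ) (φ := E) i).hasFDerivWithinAt h ?_
  exact congrFun ((extChartAt (ModelWithCorners.pi I) k).right_inv (mem_extChartAt_target k)) i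

end Pi

section PiSpace

variable {F : Type*} [NormedAddCommGroup F] [NormedSpace ℝ F] {H : Type*} [TopologicalSpace H]
  {I : ModelWithCorners ℝ F H} {M : Type*} [TopologicalSpace M] [ChartedSpace H M]
  {ι : Type*} [Fintype ι] {V : ι → Type*} [∀ i, NormedAddCommGroup (V i)]
  [∀ i, NormedSpace ℝ (V i)]

theorem hasMFDerivAt_pi_space {f : ∀ i, M → V i} {x : M} {f' : ∀ i, F →L[ℝ] V i}
    (h : ∀ i, HasMFDerivAt I 𝓘(ℝ, V i) (f i) x (f' i)) :
    HasMFDerivAt I 𝓘(ℝ, ∀ i, V i) (fun y i => f i y) x (ContinuousLinearMap.pi f') :=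
  ⟨continuousAt_pi.2 fun i => (h i).1, hasFDerivWithinAt_pi.2 fun i => (h i).2⟩

end PiSpace

/-! ### Tensor product representations and the torus factor -/

section Tensor

variable {ι : Type*} [Fintype ι] {V : ι → Type*} [∀ i, NormedAddCommGroup (V i)]
  [∀ i, InnerProductSpace ℂ (V i)] {W : Type*} [NormedAddCommGroup W] [InnerProductSpace ℂ W]
  {τ : MultilinearMap ℂ V W}

namespace IsHermitianTensorProduct

theorem norm_map (hτ : IsHermitianTensorProduct τ) (v : ∀ i, V i) : ‖τ v‖ = ∏ i, ‖v i‖ := by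
  have h := hτ.inner_map v v
  simp only [inner_self_eq_norm_sq_to_K] at h
  have h' : ‖τ v‖ ^ 2 = (∏ i, ‖v i‖) ^ 2 := by
    rw [← Finset.prod_pow]
    exact_mod_cast h
  exact (sq_eq_sq₀ (norm_nonneg _) (Finset.prod_nonneg fun _ _ => norm_nonneg _)).1 h'

/-- Decomposable tensors span `W`. -/
theorem ext_clm (hτ : IsHermitianTensorProduct τ) {A B : W →L[ℂ] W}
    (h : ∀ v, A (τ v) = B (τ v)) : A = B := by
  have h1 : (A : W →ₗ[ℂ] W) ∘ₗ PiTensorProduct.lift τ = (B : W →ₗ[ℂ] W) ∘ₗ PiTensorProduct.lift τ := by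
    refine PiTensorProduct.ext (MultilinearMap.ext fun v => ?_)
    simpa using h v
  ext w
  obtain ⟨x, rfl⟩ := hτ.bijective_lift.2 w
  exact DFunLike.congr_fun h1 x

/-- The structure map of a Hermitian tensor product, as a continuous real multilinear map. -/
def toContinuous (hτ : IsHermitianTensorProduct τ) : ContinuousMultilinearMap ℝ V W :=
  (τ.mkContinuous 1 fun v => by rw [hτ.norm_map, one_mul]).restrictScalars ℝ

end IsHermitianTensorProduct

namespace UnitaryRep

variable [DecidableEq ι] {E : ι → Type*} [∀ i, NormedAddCommGroup (E i)] [∀ i, NormedSpace ℝ (E i)]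
  {H : ι → Type*} [∀ i, TopologicalSpace (H i)] {I : ∀ i, ModelWithCorners ℝ (E i) (H i)}
  {K : ι → Type*} [∀ i, TopologicalSpace (K i)] [∀ i, ChartedSpace (H i) (K i)]
  [∀ i, Group (K i)]

theorem hasMFDerivAt_tensor (ρ : ∀ i, UnitaryRep (I i) (K i) (V i))
    (hτ : IsHermitianTensorProduct τ) (v : ∀ i, V i) :
    HasMFDerivAt (ModelWithCorners.pi I) 𝓘(ℝ, W)
      (fun k : ∀ i, K i => τ fun i => (ρ i).toHom (k i) (v i)) 1
      ((hτ.toContinuous.linearDeriv v) ∘L ContinuousLinearMap.pi fun i =>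
        (evalAt (v i) ∘L (show E i →L[ℝ] (V i →L[ℂ] V i) from (ρ i).differential)) ∘L
          ContinuousLinearMap.proj (R := ℝ) (φ := E) i) := by
  let D : ∀ i, (∀ i, E i) →L[ℝ] V i := fun i =>
    (evalAt (v i) ∘L (show E i →L[ℝ] (V i →L[ℂ] V i) from (ρ i).differential)) ∘L
      ContinuousLinearMap.proj (R := ℝ) (φ := E) i
  have h1 : ∀ i, HasMFDerivAt (ModelWithCorners.pi I) 𝓘(ℝ, V i)
      (fun k : ∀ i, K i => (ρ i).toHom (k i) (v i)) 1 (D i) := fun i =>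
    HasMFDerivAt.comp (1 : ∀ i, K i)
      ((ρ i).hasMFDerivAt_comp_toHom ((evalAt (v i)).hasFDerivAt (x := 1)))
      (hasMFDerivAt_pi_apply I (1 : ∀ i, K i) i)
  have h2 := hasMFDerivAt_pi_space h1
  have h3 : (fun i => (ρ i).toHom ((1 : ∀ i, K i) i) (v i)) = v := by
    ext i; simp
  have h4 : HasFDerivAt hτ.toContinuous (hτ.toContinuous.linearDeriv v)
      (fun i => (ρ i).toHom ((1 : ∀ i, K i) i) (v i)) := by
    rw [h3]; exact hτ.toContinuous.hasFDerivAt v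
  exact h4.hasMFDerivAt.comp (1 : ∀ i, K i) h2

variable {F₀ : Type*} [NormedAddCommGroup F₀] [NormedSpace ℝ F₀] {H₀ : Type*}
  [TopologicalSpace H₀] {I₀ : ModelWithCorners ℝ F₀ H₀} {T : Type*} [TopologicalSpace T]
  [ChartedSpace H₀ T]

variable (I₀ T) in
/-- An element of the Lie algebra of the product group `T × ∏ i, K i`. -/
def lieMk [Group T] (ξ : F₀) (X : ∀ i, GroupLieAlgebra (I i) (K i)) :
    GroupLieAlgebra (I₀.prod (ModelWithCorners.pi I)) (T × (∀ i, K i)) :=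
  (show F₀ × (∀ i, E i) from (ξ, X))

omit [DecidableEq ι] in
theorem exists_eq_lieMk [Group T]
    (Z : GroupLieAlgebra (I₀.prod (ModelWithCorners.pi I)) (T × (∀ i, K i))) :
    ∃ ξ X, Z = lieMk I₀ T ξ X :=
  ⟨(show F₀ × (∀ i, E i) from Z).1, (show F₀ × (∀ i, E i) from Z).2, rfl⟩

omit [DecidableEq ι] in
theorem lieMk_eq_add [Group T] (ξ : F₀) (X : ∀ i, GroupLieAlgebra (I i) (K i)) :
    lieMk I₀ T ξ X = lieMk I₀ T ξ (0 : ∀ i, E i) + lieMk I₀ T 0 X :=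
  Prod.ext (add_zero (M := F₀) ξ).symm (zero_add (M := ∀ i, E i) X).symm

/-- The derivative of a representation of a product along the second factor. -/
theorem differential_inr_apply [Group T]
    (ρ : ∀ i, UnitaryRep (I i) (K i) (V i)) (hτ : IsHermitianTensorProduct τ)
    (R : UnitaryRep (I₀.prod (ModelWithCorners.pi I)) (T × (∀ i, K i)) W)
    (hRτ : ∀ (k : ∀ i, K i) (v : ∀ i, V i),
      R.toHom (1, k) (τ v) = τ fun i => (ρ i).toHom (k i) (v i))
    (X : ∀ i, GroupLieAlgebra (I i) (K i)) (v : ∀ i, V i) :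
    R.differential (lieMk I₀ T 0 X) (τ v) =
      ∑ i, τ (Function.update v i ((ρ i).differential (X i) (v i))) := by
  have h1 := R.hasMFDerivAt_comp_toHom ((evalAt (τ v)).hasFDerivAt (x := 1))
  have h2 : HasMFDerivAt (ModelWithCorners.pi I) (I₀.prod (ModelWithCorners.pi I))
      (fun k : ∀ i, K i => ((1 : T), k)) 1
      ((0 : (∀ i, E i) →L[ℝ] F₀).prod (ContinuousLinearMap.id ℝ (∀ i, E i))) :=
    (hasMFDerivAt_const (1 : T) (1 : ∀ i, K i)).prodMk (hasMFDerivAt_id (1 : ∀ i, K i))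
  have h3 := HasMFDerivAt.comp (1 : ∀ i, K i) h1 h2
  have h4 : ((fun g => evalAt (τ v) (R.toHom g)) ∘ fun k : ∀ i, K i => ((1 : T), k)) =
      fun k : ∀ i, K i => τ fun i => (ρ i).toHom (k i) (v i) := by
    ext k; exact hRτ k v
  rw [h4] at h3
  have h5 := DFunLike.congr_fun (hasMFDerivAt_unique h3 (hasMFDerivAt_tensor ρ hτ v)) X
  refine h5.trans ?_
  change hτ.toContinuous.linearDeriv v (fun i => (ρ i).differential (X i) (v i)) = _
  rw [ContinuousMultilinearMap.linearDeriv_apply]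
  rfl

omit [DecidableEq ι] in
/-- A commutative first factor acts by scalars. -/
theorem exists_toHom_inl_eq_smul {T : Type*} [TopologicalSpace T] [ChartedSpace H₀ T] [CommGroup T]
    [FiniteDimensional ℂ W]
    (R : UnitaryRep (I₀.prod (ModelWithCorners.pi I)) (T × (∀ i, K i)) W)
    (hR : R.IsIrreducible) (s : T) : ∃ c : ℂ, ∀ w, R.toHom (s, 1) w = c • w := by
  obtain ⟨hW, hirr⟩ := hR
  -- Schur's lemma: (s, 1) is central, so its eigenspace is invariant and hence everything.
  obtain ⟨c, hc⟩ := Module.End.exists_eigenvalue (R.toHom (s, 1) : W →ₗ[ℂ] W)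
  refine ⟨c, fun w => ?_⟩
  have htop := (hirr (Module.End.eigenspace (R.toHom (s, 1) : W →ₗ[ℂ] W) c) ?_).resolve_left hc
  · exact Module.End.mem_eigenspace_iff.1 (htop ▸ Submodule.mem_top)
  · intro g w hw
    rw [Module.End.mem_eigenspace_iff] at hw ⊢
    have h1 : ((s, 1) : T × (∀ i, K i)) * g = g * (s, 1) := by
      ext <;> simp [mul_comm]
    change R.toHom (s, 1) (R.toHom g w) = _
    rw [← mul_apply_eq_comp, ← map_mul, h1, map_mul, mul_apply_eq_comp]
    refine (congrArg (R.toHom g) hw).trans ?_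
    rw [map_smul]

omit [DecidableEq ι] in
theorem exists_differential_inl_eq_smul {T : Type*} [TopologicalSpace T] [ChartedSpace H₀ T]
    [CommGroup T] [FiniteDimensional ℂ W]
    (R : UnitaryRep (I₀.prod (ModelWithCorners.pi I)) (T × (∀ i, K i)) W)
    (hR : R.IsIrreducible) (ξ : F₀) :
    ∃ θ : ℝ, ∀ w, R.differential (lieMk I₀ T ξ (0 : ∀ i, E i)) w = ((θ : ℂ) * Complex.I) • w := by
  have hW := hR.1
  obtain ⟨e, he⟩ := exists_norm_eq W zero_le_one
  -- This linear map tests whether A acts on w by the scalar ⟨e, A e⟩. It vanishes on the torus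
  -- operators, hence on their derivative.
  let Ψ : W → (W →L[ℂ] W) →L[ℝ] W := fun w =>
    evalAt w - ((ContinuousLinearMap.toSpanSingleton ℂ w ∘L innerSL ℂ e).restrictScalars ℝ) ∘L
      evalAt e
  have hΨ : ∀ w A, Ψ w A = A w - inner ℂ e (A e) • w := fun w A => rfl
  have h2 : HasMFDerivAt I₀ (I₀.prod (ModelWithCorners.pi I))
      (fun s : T => (s, (1 : ∀ i, K i))) 1
      ((ContinuousLinearMap.id ℝ F₀).prod (0 : F₀ →L[ℝ] (∀ i, E i))) :=
    (hasMFDerivAt_id (1 : T)).prodMk (hasMFDerivAt_const (1 : ∀ i, K i) (1 : T))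
  have h3 : ∀ w, R.differential (lieMk I₀ T ξ (0 : ∀ i, E i)) w =
      inner ℂ e (R.differential (lieMk I₀ T ξ (0 : ∀ i, E i)) e) • w := by
    intro w
    have h4 := HasMFDerivAt.comp (1 : T) (R.hasMFDerivAt_comp_toHom ((Ψ w).hasFDerivAt (x := 1))) h2
    have h5 : ((fun g => Ψ w (R.toHom g)) ∘ fun s : T => (s, (1 : ∀ i, K i))) = fun _ => 0 := by
      ext s
      obtain ⟨c, hc⟩ := R.exists_toHom_inl_eq_smul hR s
      simp only [Function.comp_apply, hΨ, hc, inner_smul_right, inner_self_eq_norm_sq_to_K, he]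
      simp
    rw [h5] at h4
    have h6 := DFunLike.congr_fun (hasMFDerivAt_unique h4 (hasMFDerivAt_const (0 : W) (1 : T))) ξ
    have h7 : Ψ w (R.differential (lieMk I₀ T ξ (0 : ∀ i, E i))) = 0 := h6
    rw [hΨ] at h7
    exact sub_eq_zero.1 h7
  refine ⟨(inner ℂ e (R.differential (lieMk I₀ T ξ (0 : ∀ i, E i)) e)).im, fun w => ?_⟩
  have h8 := R.re_inner_orbitTangent (R.differential_mem_orbitTangent (lieMk I₀ T ξ (0 : ∀ i, E i)) e)
  conv_lhs => rw [h3]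
  congr 1
  apply Complex.ext <;> simp [h8]

section Product

variable {T : Type*} [TopologicalSpace T] [ChartedSpace H₀ T] [CommGroup T]
  [FiniteDimensional ℂ W] {ρ : ∀ i, UnitaryRep (I i) (K i) (V i)}
  {R : UnitaryRep (I₀.prod (ModelWithCorners.pi I)) (T × (∀ i, K i)) W}

theorem exists_differential_tensor (hτ : IsHermitianTensorProduct τ) (hR : R.IsIrreducible)
    (hRτ : ∀ (k : ∀ i, K i) (v : ∀ i, V i),
      R.toHom (1, k) (τ v) = τ fun i => (ρ i).toHom (k i) (v i)) (ξ : F₀) :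
    ∃ θ : ℝ, ∀ (X : ∀ i, GroupLieAlgebra (I i) (K i)) (v : ∀ i, V i),
      R.differential (lieMk I₀ T ξ X) (τ v) = ((θ : ℂ) * Complex.I) • τ v +
        ∑ i, τ (Function.update v i ((ρ i).differential (X i) (v i))) := by
  obtain ⟨θ, hθ⟩ := R.exists_differential_inl_eq_smul hR ξ
  refine ⟨θ, fun X v => ?_⟩
  rw [← hθ, ← differential_inr_apply ρ hτ R hRτ X v, ← add_apply, ← map_add,
    ← lieMk_eq_add]

/-- Checked on decomposable tensors: the torus part is scalar, so its component ξ is unchanged, and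
the other components are conjugated factor by factor. -/
theorem conjInvariant_tensor (hτ : IsHermitianTensorProduct τ) (hR : R.IsIrreducible)
    (hRτ : ∀ (k : ∀ i, K i) (v : ∀ i, V i),
      R.toHom (1, k) (τ v) = τ fun i => (ρ i).toHom (k i) (v i))
    (hρ : ∀ i, (ρ i).ConjInvariant) : R.ConjInvariant := by
  rintro ⟨s, k⟩ Z
  obtain ⟨ξ, X, rfl⟩ := exists_eq_lieMk Z
  choose X' hX' using fun i => hρ i (k i) (X i)
  obtain ⟨θ, hθ⟩ := exists_differential_tensor hτ hR hRτ ξ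
  obtain ⟨c, hc⟩ := R.exists_toHom_inl_eq_smul hR s
  have hg : ∀ w, R.toHom (s, k) w = c • R.toHom (1, k) w := fun w => by
    rw [← hc, ← mul_apply_eq_comp, ← map_mul]
    simp
  refine ⟨lieMk I₀ T ξ X', fun w => ?_⟩
  have h : R.differential (lieMk I₀ T ξ X) * R.toHom (s, k) = R.toHom (s, k) * R.differential (lieMk I₀ T ξ X') := by
    refine hτ.ext_clm fun v => ?_
    rw [mul_apply_eq_comp, mul_apply_eq_comp, hg, hg, map_smul, hRτ, hθ, hθ, map_add, map_smul,
      map_sum, hRτ]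
    congr 2
    refine Finset.sum_congr rfl fun i _ => ?_
    rw [hRτ, hX']
    congr 1
    ext j
    by_cases hj : j = i
    · subst hj; simp
    · simp [hj]
  exact DFunLike.congr_fun h w

end Product

end UnitaryRep

end Tensor

/-! ### The norm estimate for variations of decomposable tensors -/

section Estimate

variable {ι : Type*} [Fintype ι] {V : ι → Type*} [∀ i, NormedAddCommGroup (V i)]
  [∀ i, InnerProductSpace ℂ (V i)] {W : Type*} [NormedAddCommGroup W] [InnerProductSpace ℂ W]
  {τ : MultilinearMap ℂ V W}

namespace IsHermitianTensorProduct

theorem inner_eq_zero (hτ : IsHermitianTensorProduct τ) {e f : ∀ i, V i} (k : ι)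
    (h : inner ℂ (e k) (f k) = 0) : inner ℂ (τ e) (τ f) = 0 := by
  rw [hτ.inner_map]
  exact Finset.prod_eq_zero (Finset.mem_univ k) h

variable [DecidableEq ι]

theorem norm_update (hτ : IsHermitianTensorProduct τ) {p : ∀ i, V i} (hp : ∀ i, ‖p i‖ = 1) (i : ι)
    (x : V i) : ‖τ (Function.update p i x)‖ = ‖x‖ := by
  rw [hτ.norm_map, Finset.prod_eq_single i]
  · simp
  · intro j _ hj
    rw [Function.update_of_ne hj, hp]
  · simp

theorem norm_update_update (hτ : IsHermitianTensorProduct τ) {p : ∀ i, V i} (hp : ∀ i, ‖p i‖ = 1)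
    {i j : ι} (hij : i ≠ j) (x : V i) (y : V j) :
    ‖τ (Function.update (Function.update p i x) j y)‖ = ‖x‖ * ‖y‖ := by
  rw [hτ.norm_map, Finset.prod_eq_mul i j hij]
  · simp [Function.update_of_ne hij]
  · intro k _ hk
    rw [Function.update_of_ne hk.2, Function.update_of_ne hk.1, hp]
  · simp
  · simp

/-- Pythagoras: any two of these tensors are orthogonal in a slot where just one of them is altered.
-/
theorem norm_sq_smul_add_sum (hτ : IsHermitianTensorProduct τ) {p : ∀ i, V i}
    (hp : ∀ i, ‖p i‖ = 1) {u : ∀ i, V i} (hu : ∀ i, inner ℂ (p i) (u i) = 0) (c : ℂ) :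
    ‖c • τ p + ∑ i, τ (Function.update p i (u i))‖ ^ 2 = ‖c‖ ^ 2 + ∑ i, ‖u i‖ ^ 2 := by
  have hτp : ‖τ p‖ = 1 := by rw [hτ.norm_map]; simp [hp]
  have h1 : inner ℂ (c • τ p) (∑ i, τ (Function.update p i (u i))) = 0 := by
    rw [inner_sum]
    refine Finset.sum_eq_zero fun i _ => ?_
    rw [inner_smul_left, hτ.inner_eq_zero i (by simpa using hu i), mul_zero]
  have h2 := norm_add_sq_eq_norm_sq_add_norm_sq_of_inner_eq_zero _ _ h1
  rw [← sq, ← sq, ← sq] at h2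
  rw [h2, norm_smul, hτp, mul_one]
  congr 1
  have h3 : inner ℂ (∑ i, τ (Function.update p i (u i))) (∑ i, τ (Function.update p i (u i))) =
      ∑ i, inner ℂ (τ (Function.update p i (u i))) (τ (Function.update p i (u i))) := by
    rw [sum_inner]
    refine Finset.sum_congr rfl fun i _ => ?_
    rw [inner_sum]
    refine Finset.sum_eq_single i (fun j _ hj => ?_) (by simp)
    refine hτ.inner_eq_zero j ?_
    rw [Function.update_of_ne hj, Function.update_self, hu]
  simp only [inner_self_eq_norm_sq_to_K, hτ.norm_update hp] at h3
  exact_mod_cast h3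

/-- The key estimate: the first and second order variations of a decomposable unit vector. -/
theorem norm_sum_le (hτ : IsHermitianTensorProduct τ) {p : ∀ i, V i} (hp : ∀ i, ‖p i‖ = 1)
    {u v w : ∀ i, V i} (hu : ∀ i, inner ℂ (p i) (u i) = 0) (hv : ∀ i, inner ℂ (p i) (v i) = 0)
    (hw : ∀ i, inner ℂ (p i) (w i) = 0) {C : ℝ} (hC0 : 0 ≤ C) (hC : 2 ≤ C ^ 2)
    (hwC : ∀ i, ‖w i‖ ≤ C * ‖u i‖ * ‖v i‖) (hu1 : ∑ i, ‖u i‖ ^ 2 ≤ 1) (hv1 : ∑ i, ‖v i‖ ^ 2 ≤ 1) :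
    ‖∑ i, ∑ j, τ (if i = j then Function.update p i (w i) else
      Function.update (Function.update p i (u i)) j (v j))‖ ≤ C := by
  let e : ι × ι → ∀ i, V i := fun x => if x.1 = x.2 then Function.update p x.1 (w x.1) else
      Function.update (Function.update p x.1 (u x.1)) x.2 (v x.2)
  let b : ι × ι → W := fun x => τ (e x)
  let B : ι × ι → ℝ := fun x => C ^ 2 * (‖u x.1‖ ^ 2 * ‖v x.2‖ ^ 2)
  have he1 : ∀ x k, k ≠ x.1 → k ≠ x.2 → e x k = p k := by
    rintro ⟨i, j⟩ k h1 h2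
    simp only [e]
    split_ifs
    · rw [Function.update_of_ne h1]
    · rw [Function.update_of_ne h2, Function.update_of_ne h1]
  have he2 : ∀ x k, (k = x.1 ∨ k = x.2) → inner ℂ (p k) (e x k) = 0 := by
    rintro ⟨i, j⟩ k hk
    simp only [e] at hk ⊢
    split_ifs with h
    · subst h
      obtain rfl : k = i := by simpa using hk
      simpa using hw k
    · by_cases hkj : k = j
      · subst hkj; simpa using hv k
      · obtain rfl : k = i := hk.resolve_right hkj
        rw [Function.update_of_ne hkj]
        simpa using hu k
  have hsep : ∀ x y k, (k = x.1 ∨ k = x.2) → k ≠ y.1 → k ≠ y.2 → inner ℂ (b x) (b y) = 0 := by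
    intro x y k h1 h2 h3
    refine hτ.inner_eq_zero k ?_
    rw [he1 y k h2 h3, ← inner_conj_symm, he2 x k h1, map_zero]
  have hsep' : ∀ x y k, (k = x.1 ∨ k = x.2) → k ≠ y.1 → k ≠ y.2 → inner ℂ (b y) (b x) = 0 := by
    intro x y k h1 h2 h3
    rw [← inner_conj_symm, hsep x y k h1 h2 h3, map_zero]
  -- Different unordered pairs {i, j} leave a slot altered in only one of the two tensors.
  have horth : ∀ x y, y ≠ x → y ≠ x.swap → inner ℂ (b x) (b y) = 0 := by
    rintro ⟨i, j⟩ ⟨k, l⟩ h1 h2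
    by_cases hi : i ≠ k ∧ i ≠ l
    · exact hsep _ _ i (Or.inl rfl) hi.1 hi.2
    by_cases hj : j ≠ k ∧ j ≠ l
    · exact hsep _ _ j (Or.inr rfl) hj.1 hj.2
    by_cases hk : k ≠ i ∧ k ≠ j
    · exact hsep' _ _ k (Or.inl rfl) hk.1 hk.2
    by_cases hl : l ≠ i ∧ l ≠ j
    · exact hsep' _ _ l (Or.inr rfl) hl.1 hl.2
    exfalso
    simp only [Prod.swap_prod_mk, ne_eq, Prod.mk.injEq] at h1 h2
    grind
  have hdiag : ∀ i, ‖b (i, i)‖ ^ 2 ≤ B (i, i) := by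
    intro i
    have h1 : ‖b (i, i)‖ = ‖w i‖ := by
      simp only [b, e, if_true]
      exact hτ.norm_update hp i (w i)
    have h2 := pow_le_pow_left₀ (norm_nonneg _) (hwC i) 2
    rw [h1]
    simp only [B]
    linarith [show (C * ‖u i‖ * ‖v i‖) ^ 2 = C ^ 2 * (‖u i‖ ^ 2 * ‖v i‖ ^ 2) by ring]
  -- The only use of C² ≥ 2: it absorbs the factor 2 from the interaction of (i, j) with (j, i).
  have hoff : ∀ x : ι × ι, x.1 ≠ x.2 → 2 * ‖b x‖ ^ 2 ≤ B x := by
    intro x hx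
    have h1 : ‖b x‖ = ‖u x.1‖ * ‖v x.2‖ := by
      simp only [b, e, if_neg hx]
      exact hτ.norm_update_update hp hx _ _
    rw [h1, mul_pow]
    exact mul_le_mul_of_nonneg_right hC (by positivity)
  -- With a = ‖b x‖ and a' = ‖b x.swap‖, an off-diagonal row is at most a² + a a' ≤ (3/2) a² + (1/2)
  -- a'², and 2a² ≤ `B x` turns this into the weights 3/4 and 1/4. Summation over x restores the
  -- total weight 1.
  have hrow : ∀ x, ∑ y, (inner ℂ (b x) (b y)).re ≤ 3 / 4 * B x + 1 / 4 * B x.swap := by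
    intro x
    have hself : (inner ℂ (b x) (b x)).re = ‖b x‖ ^ 2 := by
      rw [inner_self_eq_norm_sq_to_K]
      exact_mod_cast rfl
    by_cases hx : x.1 = x.2
    · have hsw : x.swap = x := Prod.ext hx.symm hx
      rw [Finset.sum_eq_single x (fun y _ hy => by rw [horth x y hy (by rwa [hsw])]; rfl) (by simp),
        hself, hsw]
      have := hdiag x.1
      have hx' : x = (x.1, x.1) := Prod.ext rfl hx.symm
      rw [← hx'] at this
      linarith
    · have hne : x ≠ x.swap := fun h => hx (congrArg Prod.fst h)
      rw [Finset.sum_eq_add x x.swap hne (fun y _ hy => by rw [horth x y hy.1 hy.2]; rfl) (by simp)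
        (by simp), hself]
      have h1 : (inner ℂ (b x) (b x.swap)).re ≤ ‖b x‖ * ‖b x.swap‖ :=
        (Complex.re_le_norm _).trans (norm_inner_le_norm _ _)
      have h2 := hoff x hx
      have h3 := hoff x.swap fun h => hx h.symm
      nlinarith [sq_nonneg (‖b x‖ - ‖b x.swap‖)]
  have hsum : ∑ x, B x ≤ C ^ 2 := by
    have h1 : ∑ x, B x = C ^ 2 * ((∑ i, ‖u i‖ ^ 2) * ∑ j, ‖v j‖ ^ 2) := by
      rw [Fintype.sum_prod_type, Finset.sum_mul_sum, Finset.mul_sum]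
      exact Finset.sum_congr rfl fun i _ => by rw [Finset.mul_sum]
    rw [h1]
    have h2 : (∑ i, ‖u i‖ ^ 2) * ∑ j, ‖v j‖ ^ 2 ≤ 1 :=
      mul_le_one₀ hu1 (Finset.sum_nonneg fun _ _ => by positivity) hv1
    nlinarith [sq_nonneg C]
  have hswap : ∑ x : ι × ι, B x.swap = ∑ x, B x := (Equiv.prodComm ι ι).sum_comp B
  have hb : ∑ i, ∑ j, τ (if i = j then Function.update p i (w i) else
      Function.update (Function.update p i (u i)) j (v j)) = ∑ x, b x :=
    (Fintype.sum_prod_type b).symm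
  rw [hb]
  refine (sq_le_sq₀ (norm_nonneg _) hC0).1 ?_
  have h1 : ‖∑ x, b x‖ ^ 2 = ∑ x, ∑ y, (inner ℂ (b x) (b y)).re := by
    have h2 : (inner ℂ (∑ x, b x) (∑ x, b x)).re = ‖∑ x, b x‖ ^ 2 := by
      rw [inner_self_eq_norm_sq_to_K]
      exact_mod_cast rfl
    rw [← h2, sum_inner, Complex.re_sum]
    refine Finset.sum_congr rfl fun x _ => ?_
    rw [inner_sum, Complex.re_sum]
  calc ‖∑ x, b x‖ ^ 2 = ∑ x, ∑ y, (inner ℂ (b x) (b y)).re := h1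
    _ ≤ ∑ x, (3 / 4 * B x + 1 / 4 * B x.swap) := Finset.sum_le_sum fun x _ => hrow x
    _ = ∑ x, B x := by
      have h3 : ∑ x, 3 / 4 * B x = 3 / 4 * ∑ x, B x := (Finset.mul_sum _ _ _).symm
      have h4 : ∑ x : ι × ι, 1 / 4 * B x.swap = 1 / 4 * ∑ x, B x := by
        rw [← hswap, Finset.mul_sum]
      rw [Finset.sum_add_distrib, h3, h4]
      ring
    _ ≤ C ^ 2 := hsum

end IsHermitianTensorProduct

end Estimate

/-! ### The second fundamental form of the product orbit -/

section Main

attribute [local instance] InnerProductSpace.complexToReal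

theorem mem_sup_of_mem_orthogonal_normalSpace {V : Type*} [NormedAddCommGroup V]
    [InnerProductSpace ℂ V] [FiniteDimensional ℂ V] {S : Submodule ℝ V} {p x : V}
    (hx : x ∈ (normalSpace S p)ᗮ) : x ∈ Submodule.span ℝ {p} ⊔ S := by
  have : FiniteDimensional ℝ V := FiniteDimensional.complexToReal V
  rwa [normalSpace, Submodule.orthogonal_orthogonal] at hx

namespace UnitaryRep

/-- Normal vectors are Hermitian orthogonal to the base point if the orbit is a circle bundle. -/
theorem inner_normalSpace_eq_zero {F : Type*} [NormedAddCommGroup F] [NormedSpace ℝ F] {H : Type*}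
    [TopologicalSpace H] {I : ModelWithCorners ℝ F H} {G : Type*} [TopologicalSpace G]
    [ChartedSpace H G] [Group G] {V : Type*} [NormedAddCommGroup V] [InnerProductSpace ℂ V]
    (ρ : UnitaryRep I G V) {p w : V} (hp : Complex.I • p ∈ ρ.orbitTangent p)
    (hw : w ∈ normalSpace (ρ.orbitTangent p) p) : inner ℂ p w = 0 := by
  have h1 : inner ℝ p w = 0 := (Submodule.mem_orthogonal _ _).1 hw p
    (Submodule.mem_sup_left (Submodule.mem_span_singleton_self p))
  have h2 : inner ℝ (Complex.I • p) w = 0 := (Submodule.mem_orthogonal _ _).1 hw _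
    (Submodule.mem_sup_right hp)
  rw [real_inner_eq_re_inner ℂ] at h1 h2
  rw [inner_smul_left] at h2
  apply Complex.ext
  · simpa using h1
  · simpa using h2

variable {ι : Type*} [Fintype ι] [DecidableEq ι] {V : ι → Type*} [∀ i, NormedAddCommGroup (V i)]
  [∀ i, InnerProductSpace ℂ (V i)] [∀ i, FiniteDimensional ℂ (V i)]
  {W : Type*} [NormedAddCommGroup W] [InnerProductSpace ℂ W] [FiniteDimensional ℂ W]
  {τ : MultilinearMap ℂ V W}
  {E : ι → Type*} [∀ i, NormedAddCommGroup (E i)] [∀ i, NormedSpace ℝ (E i)]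
  {H : ι → Type*} [∀ i, TopologicalSpace (H i)] {I : ∀ i, ModelWithCorners ℝ (E i) (H i)}
  {K : ι → Type*} [∀ i, TopologicalSpace (K i)] [∀ i, ChartedSpace (H i) (K i)]
  [∀ i, Group (K i)]
  {F₀ : Type*} [NormedAddCommGroup F₀] [NormedSpace ℝ F₀] {H₀ : Type*}
  [TopologicalSpace H₀] {I₀ : ModelWithCorners ℝ F₀ H₀} {T : Type*} [TopologicalSpace T]
  [ChartedSpace H₀ T] [CommGroup T]
  {ρ : ∀ i, UnitaryRep (I i) (K i) (V i)}
  {R : UnitaryRep (I₀.prod (ModelWithCorners.pi I)) (T × (∀ i, K i)) W}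

omit [∀ i, FiniteDimensional ℂ (V i)] [FiniteDimensional ℂ W] in
theorem tensor_update_mem_orbitTangent (hτ : IsHermitianTensorProduct τ)
    (hRτ : ∀ (k : ∀ i, K i) (v : ∀ i, V i),
      R.toHom (1, k) (τ v) = τ fun i => (ρ i).toHom (k i) (v i))
    {p : ∀ i, V i} {i : ι} {x : V i} (hx : x ∈ (ρ i).orbitTangent (p i)) :
    τ (Function.update p i x) ∈ R.orbitTangent (τ p) := by
  obtain ⟨X, rfl⟩ := (ρ i).mem_orbitTangent.1 hx
  let X' : ∀ i, GroupLieAlgebra (I i) (K i) := Function.update (fun _ => 0) i X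
  have h := differential_inr_apply ρ hτ R hRτ X' p
  rw [Finset.sum_eq_single i] at h
  · have h2 : X' i = X := Function.update_self _ _ _
    rw [h2] at h
    rw [← h]
    exact R.differential_mem_orbitTangent _ _
  · intro j _ hj
    have h2 : X' j = 0 := Function.update_of_ne hj _ _
    rw [h2, map_zero, zero_apply, MultilinearMap.map_update_zero]
  · simp

omit [∀ i, FiniteDimensional ℂ (V i)] in
-- The imaginary multiples of `p i` from all factors, and the torus scalar, all contribute multiples
-- of the one vector `τ p`, so they merge into a single coefficient.
theorem exists_orbitTangent_tensor_eq (hτ : IsHermitianTensorProduct τ) (hR : R.IsIrreducible)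
    (hRτ : ∀ (k : ∀ i, K i) (v : ∀ i, V i),
      R.toHom (1, k) (τ v) = τ fun i => (ρ i).toHom (k i) (v i))
    {p : ∀ i, V i}
    (h : ∀ i X, ∃ r : ℝ, ∃ n ∈ complexPart ((ρ i).orbitTangent (p i)),
      (ρ i).differential X (p i) = ((r : ℂ) * Complex.I) • p i + n)
    {u : W} (hu : u ∈ R.orbitTangent (τ p)) :
    ∃ b : ℝ, ∃ n : ∀ i, V i, (∀ i, n i ∈ complexPart ((ρ i).orbitTangent (p i))) ∧
      u = ((b : ℂ) * Complex.I) • τ p + ∑ i, τ (Function.update p i (n i)) := by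
  obtain ⟨Z, rfl⟩ := R.mem_orbitTangent.1 hu
  obtain ⟨ξ, X, rfl⟩ := exists_eq_lieMk Z
  obtain ⟨θ, hθ⟩ := exists_differential_tensor hτ hR hRτ ξ
  choose r n hn hr using fun i => h i (X i)
  refine ⟨θ + ∑ i, r i, n, hn, ?_⟩
  rw [hθ]
  simp only [hr, MultilinearMap.map_update_add, MultilinearMap.map_update_smul,
    Function.update_eq_self, Finset.sum_add_distrib, ← Finset.sum_smul, ← Finset.sum_mul]
  rw [← add_assoc, ← add_smul]
  push_cast
  rw [add_mul]

theorem norm_secondFundForm_tensor_le (hτ : IsHermitianTensorProduct τ) (hR : R.IsIrreducible)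
    (hRτ : ∀ (k : ∀ i, K i) (v : ∀ i, V i),
      R.toHom (1, k) (τ v) = τ fun i => (ρ i).toHom (k i) (v i))
    (hρ : ∀ i, (ρ i).ConjInvariant) {p : ∀ i, V i} (hp : ∀ i, ‖p i‖ = 1)
    (h : ∀ i X, ∃ r : ℝ, ∃ n ∈ complexPart ((ρ i).orbitTangent (p i)),
      (ρ i).differential X (p i) = ((r : ℂ) * Complex.I) • p i + n)
    (hI : ∀ i, (ρ i).orbitTangent (p i) = ⊥ ∨ Complex.I • p i ∈ (ρ i).orbitTangent (p i))
    {C : ℝ} (hC0 : 0 ≤ C) (hC : 2 ≤ C ^ 2)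
    (hII : ∀ i, (ρ i).orbitSecondFundNorm (p i) ≤ ENNReal.ofReal C)
    {u v : W} (hu : u ∈ R.orbitTangent (τ p)) (hv : v ∈ R.orbitTangent (τ p))
    (hu1 : ‖u‖ = 1) (hv1 : ‖v‖ = 1) :
    ‖secondFundForm (R.orbit (τ p)) R.orbitTangent (τ p) u v‖ ≤ C := by
  obtain ⟨b, m, hm, hum⟩ := exists_orbitTangent_tensor_eq hτ hR hRτ h hu
  obtain ⟨a, n, hn, hvn⟩ := exists_orbitTangent_tensor_eq hτ hR hRτ h hv
  have hm0 : ∀ i, inner ℂ (p i) (m i) = 0 := fun i => (ρ i).inner_complexPart (hm i)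
  have hn0 : ∀ i, inner ℂ (p i) (n i) = 0 := fun i => (ρ i).inner_complexPart (hn i)
  have hm1 : ∑ i, ‖m i‖ ^ 2 ≤ 1 := by
    have := hτ.norm_sq_smul_add_sum hp hm0 ((b : ℂ) * Complex.I)
    rw [← hum, hu1] at this
    nlinarith [sq_nonneg ‖(b : ℂ) * Complex.I‖]
  have hn1 : ∑ i, ‖n i‖ ^ 2 ≤ 1 := by
    have := hτ.norm_sq_smul_add_sum hp hn0 ((a : ℂ) * Complex.I)
    rw [← hvn, hv1] at this
    nlinarith [sq_nonneg ‖(a : ℂ) * Complex.I‖]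
  choose X hX using fun i => (ρ i).mem_orbitTangent.1 (hn i).1
  have hXp : R.differential (lieMk I₀ T 0 X) (τ p) = ∑ i, τ (Function.update p i (n i)) := by
    rw [differential_inr_apply ρ hτ R hRτ]
    simp only [hX]
  -- The phase term is tangent by itself, so adding the scalar ia to X still gives a tangent field.
  have hap : ((a : ℂ) * Complex.I) • τ p ∈ R.orbitTangent (τ p) := by
    rw [← add_sub_cancel_right (((a : ℂ) * Complex.I) • τ p) (∑ i, τ (Function.update p i (n i))),
      ← hvn, ← hXp]
    exact Submodule.sub_mem _ hv (R.differential_mem_orbitTangent _ _)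
  have hform := R.secondFundForm_differential_add (conjInvariant_tensor hτ hR hRτ hρ)
    (lieMk I₀ T 0 X) hap hu
  rw [hXp, add_comm, ← hvn] at hform
  rw [hform]
  let N : ∀ i, Submodule ℝ (V i) := fun i => normalSpace ((ρ i).orbitTangent (p i)) (p i)
  let w : ∀ i, V i := fun i => (N i).starProjection ((ρ i).differential (X i) (m i))
  have hwC : ∀ i, ‖w i‖ ≤ C * ‖m i‖ * ‖n i‖ := fun i => by
    have := (ρ i).norm_starProjection_differential_le (hρ i) hC0 (hII i) (X i) (hm i).1
    rwa [hX] at this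
  -- If the factor orbit has zero tangent space then m_i = 0; otherwise i p_i is tangent, which
  -- upgrades real to Hermitian orthogonality.
  have hw0 : ∀ i, inner ℂ (p i) (w i) = 0 := by
    intro i
    rcases hI i with hbot | hIp
    · have hmi : m i = 0 := by
        have := (hm i).1
        rwa [hbot, Submodule.mem_bot] at this
      simp [w, hmi]
    · exact (ρ i).inner_normalSpace_eq_zero hIp (Submodule.starProjection_apply_mem _ _)
  let Q : Submodule ℝ W := Submodule.span ℝ {τ p} ⊔ R.orbitTangent (τ p)
  -- The radial and tangential part of X_i m_i, which stays in `Q` when placed in slot i.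
  let z : ∀ i, V i := fun i => (ρ i).differential (X i) (m i) - w i
  have hz : ∀ i, τ (Function.update p i (z i)) ∈ Q := by
    intro i
    have h1 : z i ∈ Submodule.span ℝ {p i} ⊔ (ρ i).orbitTangent (p i) :=
      mem_sup_of_mem_orthogonal_normalSpace (Submodule.sub_starProjection_mem_orthogonal _)
    obtain ⟨y, hy, x, hx, hyx⟩ := Submodule.mem_sup.1 h1
    obtain ⟨r, rfl⟩ := Submodule.mem_span_singleton.1 hy
    rw [← hyx, MultilinearMap.map_update_add, ← Complex.coe_smul, MultilinearMap.map_update_smul,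
      Function.update_eq_self, Complex.coe_smul]
    exact Submodule.add_mem _ (Submodule.mem_sup_left
      (Submodule.smul_mem _ _ (Submodule.mem_span_singleton_self _)))
      (Submodule.mem_sup_right (tensor_update_mem_orbitTangent hτ hRτ hx))
  -- The phase cross terms disappear in the normal space because each N_i is a complex subspace.
  have hJ : ∀ (c : ℝ) (x : ∀ i, V i), (∀ i, x i ∈ complexPart ((ρ i).orbitTangent (p i))) →
      ((c : ℂ) * Complex.I) • ∑ i, τ (Function.update p i (x i)) ∈ Q := by
    intro c x hx
    rw [mul_smul, Complex.coe_smul, Finset.smul_sum]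
    refine Submodule.smul_mem _ _ (Submodule.sum_mem _ fun i _ => Submodule.mem_sup_right ?_)
    rw [← MultilinearMap.map_update_smul]
    exact tensor_update_mem_orbitTangent hτ hRτ (hx i).2
  let main : W := ∑ i, ∑ j, τ (if i = j then Function.update p i (w i) else
      Function.update (Function.update p i (m i)) j (n j))
  have hrow : ∀ i, R.differential (lieMk I₀ T 0 X) (τ (Function.update p i (m i))) =
      ∑ j, τ (if i = j then Function.update p i (w i) else
        Function.update (Function.update p i (m i)) j (n j)) + τ (Function.update p i (z i)) := by
    intro i
    rw [differential_inr_apply ρ hτ R hRτ, ← Finset.add_sum_erase _ _ (Finset.mem_univ i),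
      ← Finset.add_sum_erase Finset.univ (fun j => τ (if i = j then Function.update p i (w i) else
        Function.update (Function.update p i (m i)) j (n j))) (Finset.mem_univ i)]
    have h1 : (ρ i).differential (X i) (m i) = w i + z i := by simp [z]
    have h2 : τ (Function.update (Function.update p i (m i)) i
        ((ρ i).differential (X i) (Function.update p i (m i) i))) =
        τ (Function.update p i (w i)) + τ (Function.update p i (z i)) := by
      rw [Function.update_self, Function.update_idem, h1, MultilinearMap.map_update_add]
    have h3 : ∑ j ∈ Finset.univ.erase i, τ (Function.update (Function.update p i (m i)) j
        ((ρ j).differential (X j) (Function.update p i (m i) j))) =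
        ∑ j ∈ Finset.univ.erase i, τ (if i = j then Function.update p i (w i) else
        Function.update (Function.update p i (m i)) j (n j)) := by
      refine Finset.sum_congr rfl fun j hj => ?_
      have hji : j ≠ i := Finset.ne_of_mem_erase hj
      rw [if_neg hji.symm, Function.update_of_ne hji, hX]
    rw [h2, h3, if_pos rfl]
    abel
  have hmain : R.differential (lieMk I₀ T 0 X) u + ((a : ℂ) * Complex.I) • u - main ∈ Q := by
    have h1 : R.differential (lieMk I₀ T 0 X) u = ((b : ℂ) * Complex.I) •
        ∑ i, τ (Function.update p i (n i)) + (main + ∑ i, τ (Function.update p i (z i))) := by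
      conv_lhs => rw [hum]
      rw [map_add, map_smul, hXp, map_sum, Finset.sum_congr rfl fun i _ => hrow i,
        Finset.sum_add_distrib]
    -- The product of the phases ia and ib is real, so it contributes only in the radial direction.
    have h2 : ((a : ℂ) * Complex.I) • u = (-(a * b)) • τ p +
        ((a : ℂ) * Complex.I) • ∑ i, τ (Function.update p i (m i)) := by
      conv_lhs => rw [hum]
      rw [smul_add, smul_smul, ← Complex.coe_smul]
      congr 2
      push_cast
      linear_combination (a * b : ℂ) * Complex.I_mul_I
    have h3 : R.differential (lieMk I₀ T 0 X) u + ((a : ℂ) * Complex.I) • u - main =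
        ((b : ℂ) * Complex.I) • ∑ i, τ (Function.update p i (n i)) +
        ∑ i, τ (Function.update p i (z i)) + (-(a * b)) • τ p +
        ((a : ℂ) * Complex.I) • ∑ i, τ (Function.update p i (m i)) := by
      rw [h1, h2]; abel
    rw [h3]
    refine Submodule.add_mem _ (Submodule.add_mem _ (Submodule.add_mem _ (hJ b n hn)
      (Submodule.sum_mem _ fun i _ => hz i)) ?_) (hJ a m hm)
    exact Submodule.mem_sup_left (Submodule.smul_mem _ _ (Submodule.mem_span_singleton_self _))
  have hproj : (normalSpace (R.orbitTangent (τ p)) (τ p)).starProjection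
      (R.differential (lieMk I₀ T 0 X) u + ((a : ℂ) * Complex.I) • u) =
      (normalSpace (R.orbitTangent (τ p)) (τ p)).starProjection main := by
    rw [← sub_eq_zero, ← map_sub]
    exact (Submodule.starProjection_apply_eq_zero_iff _).2
      (Submodule.le_orthogonal_orthogonal Q hmain)
  rw [hproj]
  exact (Submodule.norm_starProjection_apply_le _ _).trans
    (hτ.norm_sum_le hp hm0 hn0 hw0 hC0 hC hwC hm1 hn1)

end UnitaryRep

end Main

end OrbitSFF

end

theorem mainTheorem2 {m : ℕ}
    -- the torus
    {d₀ : ℕ} {T : Type*} [TopologicalSpace T] [ChartedSpace (EuclideanSpace ℝ (Fin d₀)) T]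
    [CommGroup T] [LieGroup (𝓡 d₀) ∞ T] [CompactSpace T] [ConnectedSpace T] [T2Space T]
    -- the simple factors
    {d : Fin m → ℕ} {K : Fin m → Type*} [∀ i, TopologicalSpace (K i)]
    [∀ i, ChartedSpace (EuclideanSpace ℝ (Fin (d i))) (K i)] [∀ i, Group (K i)]
    [∀ i, LieGroup (𝓡 (d i)) ∞ (K i)] [∀ i, CompactSpace (K i)] [∀ i, ConnectedSpace (K i)]
    [∀ i, T2Space (K i)]
    (hsimple : ∀ i, LieAlgebra.IsSimple ℝ (GroupLieAlgebra (𝓡 (d i)) (K i)))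
    -- their irreducible representations
    {V : Fin m → Type*} [∀ i, NormedAddCommGroup (V i)] [∀ i, InnerProductSpace ℂ (V i)]
    [∀ i, FiniteDimensional ℂ (V i)]
    (ρ : ∀ i, OrbitSFF.UnitaryRep (𝓡 (d i)) (K i) (V i)) (hρ : ∀ i, (ρ i).IsIrreducible)
    -- the irreducible representation of the product group on the tensor product
    {W : Type*} [NormedAddCommGroup W] [InnerProductSpace ℂ W] [FiniteDimensional ℂ W]
    (τ : MultilinearMap ℂ V W) (hτ : OrbitSFF.IsHermitianTensorProduct τ)
    (R : OrbitSFF.UnitaryRep ((𝓡 d₀).prod (ModelWithCorners.pi fun i => 𝓡 (d i)))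
      (T × (∀ i, K i)) W)
    (hR : R.IsIrreducible)
    (hRτ : ∀ (k : ∀ i, K i) (v : ∀ i, V i),
      R.toHom (1, k) (τ v) = τ fun i => (ρ i).toHom (k i) (v i))
    -- unit highest weight vectors
    (t : ∀ i, LieSubalgebra ℝ (GroupLieAlgebra (𝓡 (d i)) (K i)))
    (ht : ∀ i, OrbitSFF.IsMaximalAbelian (t i))
    (P : ∀ i, Set (t i → ℂ)) (hP : ∀ i, OrbitSFF.IsPositiveSystem (t i) (P i))
    (p : ∀ i, V i) (hp : ∀ i, (ρ i).IsHighestWeightVector (t i) (P i) (p i))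
    (hp1 : ∀ i, ‖p i‖ = 1)
    (C : ℝ) (hC : √2 ≤ C)
    (hII : ∀ i, (ρ i).orbitSecondFundNorm (p i) ≤ ENNReal.ofReal C) :
    R.orbitSecondFundNorm (τ p) ≤ ENNReal.ofReal C := by
  have hC0 : 0 ≤ C := (Real.sqrt_nonneg 2).trans hC
  have hC2 : 2 ≤ C ^ 2 := by
    have := pow_le_pow_left₀ (Real.sqrt_nonneg 2) hC 2
    rwa [Real.sq_sqrt (by norm_num)] at this
  have h : ∀ i X, ∃ r : ℝ, ∃ n ∈ OrbitSFF.complexPart ((ρ i).orbitTangent (p i)),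
      (ρ i).differential X (p i) = ((r : ℂ) * Complex.I) • p i + n := fun i =>
    (ρ i).exists_differential_apply_eq (hsimple i) (ht i) (hP i) (hp i) (hp1 i)
  refine iSup₂_le fun u hu => iSup₂_le fun v hv => iSup₂_le fun hu1 hv1 => ?_
  rw [← ofReal_norm]
  exact ENNReal.ofReal_le_ofReal (OrbitSFF.UnitaryRep.norm_secondFundForm_tensor_le hτ hR hRτ
    (fun i => (ρ i).exists_differential_conj) hp1 h
    (fun i => (ρ i).orbitTangent_eq_bot_or_I_smul_mem (h i)) hC0 hC2 hII hu hv hu1 hv1)
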